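/- Let $\mathcal{B}$ be a braided rigid monoidal category with braiding $\sigma$, written as if it were strict, that admits equalizers. For an object $V$, let $V^*$ be the dual with evaluation $V^*\otimes V\to\mathbf 1$ and coevaluation $\mathbf 1\to V\otimes V^*$. Let $H$ be a Hopf algebra in $\mathcal{B}$ with multiplication $m$, unit $u$, comultiplication $\Delta$, counit $\varepsilon$ and antipode $S$. *Integrals.* A right integral in $H$ is a morphism $t:X\to H$ with $m\circ(t\otimes \mathrm{id}_H)=t\otimes\varepsilon$. The right integrals form a full subcategory of the category of objects over $H$, and this subcategory has a terminal object $\Lambda:\mathrm{Int}(H)\to H$. A modular function on $H$ is an algebra morphism $\alpha_H:H\to\mathbf 1$ with $m\circ(\mathrm{id}_H\otimes\Lambda)=\alpha_H\otimes\Lambda$. *Bimodules.* For $H$-bimodules $M,N$ the object $M\otimes N$ is an $H$-bimodule with actions $(\triangleright_M\otimes\triangleright_N)(\mathrm{id}_H\otimes\sigma_{H,M}\otimes\mathrm{id}_N)(\Delta\otimes\mathrm{id}_{M\otimes N})$ and $(\triangleleft_M\otimes\triangleleft_N)(\mathrm{id}_M\otimes\sigma_{N,H}\otimes\mathrm{id}_H)(\mathrm{id}_{M\otimes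 N}\otimes\Delta)$; right $H$-modules are tensored by the second formula. If $S$ is invertible, $M^\vee$ denotes the $H$-bimodule on the object $M^*$ for which the evaluation $M^\vee\otimes M\to\mathbf 1$ and the coevaluation $\mathbf 1\to M\otimes M^\vee$ are morphisms of bimodules, where $H$ acts on $\mathbf 1$ by $\varepsilon$; symbolically, up to braidings, $(h f)(x)=f(S(h)x)$ and $(f h)(x)=f(xS^{-1}(h))$. A Hopf bimodule is an $H$-bimodule $M$ with a left $H$-comodule structure $\delta_M:M\to H\otimes M$ that is a morphism of bimodules, where $H$ is the regular bimodule. In particular $H^\vee$ is a Hopf bimodule with the left coaction $\delta$ that corresponds by duality to the right coaction $\Delta$ on $H$, i.e. $(\mathrm{id}_H\otimes\mathrm{ev})(\delta\otimes\mathrm{id}_H)=(\mathrm{ev}\otimes\mathrm{id}_H)(\mathrm{id}_{H^*}\otimes\Delta)$. *Coinvariants.* The coinvariant part $M^{\mathrm{co}H}$ of a Hopf bimodule $M$ is the equalizer of $\pi_M=\triangleright_M\circ(S\otimes\mathrm{id}_M)\circ\delta_M$ and $\mathrm{id}_M$. It is a right $H$-module by restriction of the adjoint action $$\triangleleft_M^{\mathrm{ad}}=\triangleright_M\circ(S\otimes\triangleleft_M)\circ(\sigma_{M,H}\otimes\mathrm{id}_H)\circ(\mathrm{id}_M\otimes\Delta).$$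 **Claim.** The antipode of $H$ is invertible, there is exactly one modular function $\alpha_H$ on $H$, and $$(H^\vee)^{\mathrm{co}H}\;\cong\;\mathrm{Int}(H)^*\otimes\alpha_H$$ as right $H$-modules. Here $\mathrm{Int}(H)^*$ is a right $H$-module through $\varepsilon$, and $\alpha_H$ stands for the right $H$-module on $\mathbf 1$ on which $H$ acts through $\alpha_H$. -/

import Mathlib

open CategoryTheory MonoidalCategory Limits
open scoped MonObj ComonObj HopfObj
universe v u
set_option linter.unusedSectionVars false
namespace BraidedHopf
variable {C : Type u} [Category.{v} C] [MonoidalCategory C] [BraidedCategory C]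

/-- `a : X ⊗ H ⟶ X` is a right action of the algebra `H` on `X`. -/
structure IsRightAction {H : C} [MonObj H] {X : C} (a : X ⊗ H ⟶ X) : Prop where
  one : X ◁ η[H] ≫ a = (ρ_ X).hom
  mul : X ◁ μ[H] ≫ a = (α_ X H H).inv ≫ a ▷ H ≫ a
/-- `a : H ⊗ X ⟶ X` is a left action of the algebra `H` on `X`. -/
structure IsLeftAction {H : C} [MonObj H] {X : C} (a : H ⊗ X ⟶ X) : Prop where
  one : η[H] ▷ X ≫ a = (λ_ X).hom
  mul : μ[H] ▷ X ≫ a = (α_ H H X).hom ≫ H ◁ a ≫ a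

variable {H : C} [HopfObj H]

theorem IsRightAction.toLeft {X : C} {r : X ⊗ H ⟶ X} (hr : IsRightAction r) :
    IsLeftAction ((β_ H X).hom ≫ X ◁ 𝒮[H] ≫ r) where
  one := by
    rw [BraidedCategory.braiding_naturality_left_assoc, ← whiskerLeft_comp_assoc,
      HopfObj.one_antipode, hr.one]
    simp
  mul := by
    calc _ = (β_ (H ⊗ H) X).hom ≫ X ◁ (μ[H] ≫ 𝒮[H]) ≫ r := by simp
      _ = (β_ (H ⊗ H) X).hom ≫ X ◁ ((𝒮[H] ⊗ₘ 𝒮[H]) ≫ (β_ _ _).hom) ≫ X ◁ μ ≫ r := by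
        rw [HopfObj.mul_antipode]; simp
      _ = (α_ _ _ _).hom ≫ H ◁ (β_ H X).hom ≫ (β_ H (X ⊗ H)).hom ≫ (α_ _ _ _).hom ≫
          X ◁ (𝒮[H] ⊗ₘ 𝒮[H]) ≫ (α_ _ _ _).inv ≫ r ▷ H ≫ r := by
        rw [hr.mul, BraidedCategory.braiding_naturality]
        simp
      _ = (α_ _ _ _).hom ≫ H ◁ (β_ H X).hom ≫ ((β_ H (X ⊗ H)).hom ≫ (X ◁ 𝒮[H]) ▷ H) ≫
          ((X ⊗ H) ◁ 𝒮[H] ≫ r ▷ H) ≫ r := by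
        simp [MonoidalCategory.tensorHom_def]
      _ = _ := by
        rw [← BraidedCategory.braiding_naturality_right, whisker_exchange]
        simp

theorem IsRightAction.toLeft' {X : C} [IsIso 𝒮[H]] {r : X ⊗ H ⟶ X} (hr : IsRightAction r) :
    IsLeftAction ((β_ X H).inv ≫ X ◁ inv 𝒮[H] ≫ r) where
  one := by
    rw [BraidedCategory.braiding_inv_naturality_left_assoc, ← whiskerLeft_comp_assoc,
      show η[H] ≫ inv 𝒮[H] = η[H] by rw [IsIso.comp_inv_eq, HopfObj.one_antipode], hr.one]
    simp
  mul := by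
    have key : μ[H] ≫ inv 𝒮[H] = (inv 𝒮[H] ⊗ₘ inv 𝒮[H]) ≫ (β_ H H).inv ≫ μ[H] := by
      rw [IsIso.comp_inv_eq]
      simp only [Category.assoc, HopfObj.mul_antipode]
      rw [BraidedCategory.braiding_naturality_assoc]
      simp
    calc _ = (β_ X (H ⊗ H)).inv ≫ X ◁ (μ[H] ≫ inv 𝒮[H]) ≫ r := by simp
      _ = (β_ X (H ⊗ H)).inv ≫ X ◁ ((inv 𝒮[H] ⊗ₘ inv 𝒮[H]) ≫ (β_ _ _).inv) ≫ X ◁ μ ≫ r := by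
        rw [key]; simp
      _ = (α_ _ _ _).hom ≫ H ◁ (β_ X H).inv ≫ (β_ (X ⊗ H) H).inv ≫ (α_ _ _ _).hom ≫
          X ◁ (inv 𝒮[H] ⊗ₘ inv 𝒮[H]) ≫ (α_ _ _ _).inv ≫ r ▷ H ≫ r := by
        rw [hr.mul, BraidedCategory.braiding_inv_naturality]
        simp
      _ = (α_ _ _ _).hom ≫ H ◁ (β_ X H).inv ≫ ((β_ (X ⊗ H) H).inv ≫ (X ◁ inv 𝒮[H]) ▷ H) ≫
          ((X ⊗ H) ◁ inv 𝒮[H] ≫ r ▷ H) ≫ r := by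
        simp [MonoidalCategory.tensorHom_def]
      _ = _ := by
        rw [← BraidedCategory.braiding_inv_naturality_right, whisker_exchange]
        simp

theorem IsLeftAction.toRight {X : C} {a : H ⊗ X ⟶ X} (ha : IsLeftAction a) :
    IsRightAction ((β_ X H).hom ≫ 𝒮[H] ▷ X ≫ a) where
  one := by
    rw [BraidedCategory.braiding_naturality_right_assoc, ← comp_whiskerRight_assoc,
      HopfObj.one_antipode, ha.one]
    simp
  mul := by
    calc _ = (β_ X (H ⊗ H)).hom ≫ (μ[H] ≫ 𝒮[H]) ▷ X ≫ a := by simp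
      _ = (β_ X (H ⊗ H)).hom ≫ ((𝒮[H] ⊗ₘ 𝒮[H]) ≫ (β_ _ _).hom) ▷ X ≫ μ ▷ X ≫ a := by
        rw [HopfObj.mul_antipode]; simp
      _ = (α_ _ _ _).inv ≫ (β_ X H).hom ▷ H ≫ (β_ (H ⊗ X) H).hom ≫ (α_ _ _ _).inv ≫
          (𝒮[H] ⊗ₘ 𝒮[H]) ▷ X ≫ (α_ _ _ _).hom ≫ H ◁ a ≫ a := by
        rw [ha.mul, BraidedCategory.braiding_naturality]
        simp
      _ = (α_ _ _ _).inv ≫ (β_ X H).hom ▷ H ≫ ((β_ (H ⊗ X) H).hom ≫ H ◁ (𝒮[H] ▷ X)) ≫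
          (𝒮[H] ▷ (H ⊗ X) ≫ H ◁ a) ≫ a := by
        simp [MonoidalCategory.tensorHom_def']
      _ = _ := by
        rw [← BraidedCategory.braiding_naturality_left, ← whisker_exchange]
        simp

theorem inv_antipode_op [IsIso 𝒮[H]] :
    Δ[H] ≫ H ◁ inv 𝒮[H] ≫ (β_ H H).inv ≫ μ[H] = ε[H] ≫ η[H] := by
  rw [← cancel_mono 𝒮[H]]
  simp only [Category.assoc, HopfObj.mul_antipode, HopfObj.one_antipode]
  rw [BraidedCategory.braiding_naturality_assoc, Iso.inv_hom_id_assoc]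
  simp [MonoidalCategory.tensorHom_def', ← whiskerLeft_comp_assoc]

theorem inv_antipode_op' [IsIso 𝒮[H]] :
    Δ[H] ≫ inv 𝒮[H] ▷ H ≫ (β_ H H).inv ≫ μ[H] = ε[H] ≫ η[H] := by
  rw [← cancel_mono 𝒮[H]]
  simp only [Category.assoc, HopfObj.mul_antipode, HopfObj.one_antipode]
  rw [BraidedCategory.braiding_naturality_assoc, Iso.inv_hom_id_assoc]
  simp [MonoidalCategory.tensorHom_def, ← comp_whiskerRight_assoc]

section dual
variable {M : C} [HasRightDual M]

/-- Transpose of `f : X ⊗ M ⟶ 𝟙_ C`. Throughout, `Mᘁ` is the dual `M^*` whose evaluation is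
`ε_ M Mᘁ : Mᘁ ⊗ M ⟶ 𝟙_ C` and whose coevaluation is `η_ M Mᘁ : 𝟙_ C ⟶ M ⊗ Mᘁ`. -/
noncomputable def toDual {X : C} (f : X ⊗ M ⟶ 𝟙_ C) : X ⟶ Mᘁ :=
  tensorRightHomEquiv X M Mᘁ (𝟙_ C) f ≫ (λ_ Mᘁ).hom

theorem toDual_ev {X : C} (f : X ⊗ M ⟶ 𝟙_ C) : toDual f ▷ M ≫ ε_ M Mᘁ = f := by
  have := (tensorRightHomEquiv X M Mᘁ (𝟙_ C)).symm_apply_apply f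
  rw [toDual]
  conv_rhs => rw [← this]
  simp [tensorRightHomEquiv, unitors_inv_equal]

theorem toDual_ev' {X : C} (f : X ⟶ Mᘁ) : toDual (f ▷ M ≫ ε_ M Mᘁ) = f := by
  rw [toDual, tensorRightHomEquiv_whiskerRight_comp_evaluation]
  simp

theorem dual_hom_ext {X : C} {f g : X ⟶ Mᘁ} (h : f ▷ M ≫ ε_ M Mᘁ = g ▷ M ≫ ε_ M Mᘁ) : f = g := by
  rw [← toDual_ev' f, ← toDual_ev' g, h]

/-- Symbolically `(f · h)(m) = f(h · m)`. -/
noncomputable def dualOp (a : H ⊗ M ⟶ M) : Mᘁ ⊗ H ⟶ Mᘁ :=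
  toDual ((α_ Mᘁ H M).hom ≫ Mᘁ ◁ a ≫ ε_ M Mᘁ)

theorem dualOp_ev (a : H ⊗ M ⟶ M) :
    dualOp a ▷ M ≫ ε_ M Mᘁ = (α_ Mᘁ H M).hom ≫ Mᘁ ◁ a ≫ ε_ M Mᘁ := toDual_ev _

theorem coev_dualOp (a : H ⊗ M ⟶ M) :
    η_ M Mᘁ ▷ H ≫ (α_ _ _ _).hom ≫ M ◁ dualOp a =
      (λ_ H).hom ≫ (ρ_ H).inv ≫ H ◁ η_ M Mᘁ ≫ (α_ _ _ _).inv ≫ a ▷ Mᘁ := by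
  apply (tensorRightHomEquiv _ M Mᘁ M).symm.injective
  simp only [tensorRightHomEquiv, Equiv.coe_fn_symm_mk]
  calc _ = 𝟙 _ ⊗≫ η_ M Mᘁ ▷ (H ⊗ M) ⊗≫ M ◁ (dualOp a ▷ M ≫ ε_ M Mᘁ) ⊗≫ 𝟙 _ := by monoidal
    _ = 𝟙 _ ⊗≫ (η_ M Mᘁ ▷ (H ⊗ M) ≫ (M ⊗ Mᘁ) ◁ a) ⊗≫ M ◁ ε_ M Mᘁ ⊗≫ 𝟙 _ := by
      rw [dualOp_ev]; monoidal
    _ = 𝟙 _ ⊗≫ a ⊗≫ (η_ M Mᘁ ▷ M ⊗≫ M ◁ ε_ M Mᘁ) ⊗≫ 𝟙 _ := by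
      rw [← whisker_exchange]; monoidal
    _ = 𝟙 _ ⊗≫ a ⊗≫ 𝟙 _ := by rw [ExactPairing.evaluation_coevaluation'']; monoidal
    _ = 𝟙 _ ⊗≫ H ◁ (η_ M Mᘁ ▷ M ⊗≫ M ◁ ε_ M Mᘁ) ⊗≫ a ⊗≫ 𝟙 _ := by
      rw [ExactPairing.evaluation_coevaluation'']; monoidal
    _ = 𝟙 _ ⊗≫ H ◁ η_ M Mᘁ ▷ M ⊗≫ ((H ⊗ M) ◁ ε_ M Mᘁ ≫ a ▷ 𝟙_ C) ⊗≫ 𝟙 _ := by monoidal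
    _ = 𝟙 _ ⊗≫ H ◁ η_ M Mᘁ ▷ M ⊗≫ (a ▷ (Mᘁ ⊗ M) ≫ M ◁ ε_ M Mᘁ) ⊗≫ 𝟙 _ := by
      rw [whisker_exchange]
    _ = _ := by monoidal

theorem IsLeftAction.dual {a : H ⊗ M ⟶ M} (ha : IsLeftAction a) : IsRightAction (dualOp a) where
  one := by
    apply dual_hom_ext
    calc _ = ((Mᘁ : C) ◁ η[H]) ▷ M ≫ dualOp a ▷ M ≫ ε_ M Mᘁ := by simp
      _ = (α_ _ _ _).hom ≫ (Mᘁ : C) ◁ (η[H] ▷ M ≫ a) ≫ ε_ M Mᘁ := by rw [dualOp_ev]; simp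
      _ = _ := by rw [ha.one]; simp
  mul := by
    apply dual_hom_ext
    calc _ = ((Mᘁ : C) ◁ μ[H]) ▷ M ≫ dualOp a ▷ M ≫ ε_ M Mᘁ := by simp
      _ = (α_ _ _ _).hom ≫ (Mᘁ : C) ◁ (μ[H] ▷ M ≫ a) ≫ ε_ M Mᘁ := by rw [dualOp_ev]; simp
      _ = (α_ _ _ _).inv ▷ M ≫ (α_ _ _ _).hom ≫ (Mᘁ ⊗ H) ◁ a ≫
            ((α_ Mᘁ H M).hom ≫ Mᘁ ◁ a ≫ ε_ M Mᘁ) := by rw [ha.mul]; simp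
      _ = (α_ _ _ _).inv ▷ M ≫ (α_ _ _ _).hom ≫ ((Mᘁ ⊗ H) ◁ a ≫ dualOp a ▷ M) ≫ ε_ M Mᘁ := by
        rw [← dualOp_ev]; simp
      _ = (α_ _ _ _).inv ▷ M ≫ dualOp a ▷ H ▷ M ≫ ((α_ Mᘁ H M).hom ≫ Mᘁ ◁ a ≫ ε_ M Mᘁ) := by
        rw [whisker_exchange]; simp
      _ = _ := by rw [← dualOp_ev]; simp

theorem swap_twist (T : H ⟶ H) {a : H ⊗ M ⟶ M} {c : M ⊗ H ⟶ M}
    (h : a ▷ H ≫ c = (α_ _ _ _).hom ≫ H ◁ c ≫ a) :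
    H ◁ ((β_ M H).inv ≫ M ◁ T ≫ c) ≫ a = (α_ _ _ _).inv ≫ (β_ H H).hom ▷ M ≫ (α_ _ _ _).hom ≫
      H ◁ a ≫ ((β_ M H).inv ≫ M ◁ T ≫ c) := by
  rw [BraidedCategory.braiding_inv_naturality_right_assoc, ← whisker_exchange_assoc, h]
  simp

theorem dual_middle {a b : H ⊗ M ⟶ M}
    (h : H ◁ b ≫ a = (α_ _ _ _).inv ≫ (β_ H H).hom ▷ M ≫ (α_ _ _ _).hom ≫ H ◁ a ≫ b) :
    ((β_ H Mᘁ).hom ≫ dualOp a) ▷ H ≫ dualOp b =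
      (α_ _ _ _).hom ≫ H ◁ dualOp b ≫ (β_ H Mᘁ).hom ≫ dualOp a := by
  apply dual_hom_ext
  have key : ∀ x y : H ⊗ M ⟶ M, (dualOp x ▷ H ≫ dualOp y) ▷ M ≫ ε_ M Mᘁ =
      (α_ _ _ _).hom ≫ (α_ _ _ _).hom ≫ (Mᘁ : C) ◁ H ◁ y ≫ Mᘁ ◁ x ≫ ε_ M Mᘁ := by
    intro x y
    calc _ = dualOp x ▷ H ▷ M ≫ dualOp y ▷ M ≫ ε_ M Mᘁ := by simp
      _ = (α_ _ _ _).hom ≫ (dualOp x ▷ (H ⊗ M) ≫ (Mᘁ : C) ◁ y) ≫ ε_ M Mᘁ := by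
        rw [dualOp_ev]; simp
      _ = (α_ _ _ _).hom ≫ ((Mᘁ : C) ⊗ H) ◁ y ≫ dualOp x ▷ M ≫ ε_ M Mᘁ := by
        rw [← whisker_exchange]; simp
      _ = _ := by rw [dualOp_ev]; simp
  rw [BraidedCategory.braiding_naturality_right_assoc]
  calc _ = (β_ H Mᘁ).hom ▷ H ▷ M ≫ (dualOp a ▷ H ≫ dualOp b) ▷ M ≫ ε_ M Mᘁ := by simp
    _ = (β_ H Mᘁ).hom ▷ H ▷ M ≫ (α_ _ _ _).hom ≫ (α_ _ _ _).hom ≫ (Mᘁ : C) ◁ (H ◁ b ≫ a) ≫ ε_ M Mᘁ := by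
      rw [key]; simp
    _ = ((α_ _ _ _).hom ≫ (β_ H (Mᘁ ⊗ H)).hom) ▷ M ≫ (dualOp b ▷ H ≫ dualOp a) ▷ M ≫ ε_ M Mᘁ := by
      rw [key, h]; simp
    _ = _ := by simp
end dual

theorem combine {M : C} {r s : M ⊗ H ⟶ M} (hr : IsRightAction r) (hs : IsRightAction s)
    (h : s ▷ H ≫ r = (α_ _ _ _).hom ≫ M ◁ (β_ H H).hom ≫ (α_ _ _ _).inv ≫ r ▷ H ≫ s) :
    IsRightAction (M ◁ Δ[H] ≫ (α_ _ _ _).inv ≫ r ▷ H ≫ s) where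
  one := by
    calc _ = M ◁ (η[H] ≫ Δ[H]) ≫ (α_ _ _ _).inv ≫ r ▷ H ≫ s := by
          simp only [whiskerLeft_comp, Category.assoc]
      _ = M ◁ (λ_ (𝟙_ C)).inv ≫ M ◁ η[H] ▷ _ ≫ (α_ _ _ _).inv ≫ ((M ⊗ H) ◁ η[H] ≫ r ▷ H) ≫ s := by
        rw [Bimon.one_comul, MonoidalCategory.tensorHom_def]; simp
      _ = M ◁ (λ_ (𝟙_ C)).inv ≫ (α_ _ _ _).inv ≫ (M ◁ η[H] ≫ r) ▷ _ ≫ M ◁ η[H] ≫ s := by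
        rw [whisker_exchange]; monoidal
      _ = _ := by rw [hr.one, hs.one]; simp
  mul := by
    calc _ = M ◁ (μ[H] ≫ Δ[H]) ≫ (α_ _ _ _).inv ≫ r ▷ H ≫ s := by
          simp only [whiskerLeft_comp, Category.assoc]
      _ = M ◁ (Δ[H] ⊗ₘ Δ[H]) ≫ M ◁ tensorμ H H H H ≫ M ◁ μ[H] ▷ _ ≫ (α_ _ _ _).inv ≫
            ((M ⊗ H) ◁ μ[H] ≫ r ▷ H) ≫ s := by
        rw [BimonObj.mul_comul, MonoidalCategory.tensorHom_def μ[H]]; simp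
      _ = M ◁ (Δ[H] ⊗ₘ Δ[H]) ≫ M ◁ tensorμ H H H H ≫ (α_ _ _ _).inv ≫
            (M ◁ μ[H] ≫ r) ▷ _ ≫ M ◁ μ[H] ≫ s := by
        rw [whisker_exchange]; simp
      _ = M ◁ (Δ[H] ⊗ₘ Δ[H]) ≫ M ◁ tensorμ H H H H ≫ (α_ _ _ _).inv ≫
            (α_ _ _ _).inv ▷ _ ≫ r ▷ H ▷ (H ⊗ H) ≫ r ▷ (H ⊗ H) ≫ (α_ _ _ _).inv ≫ s ▷ H ≫ s := by
        rw [hr.mul, hs.mul]; simp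
      _ = M ◁ (Δ[H] ⊗ₘ Δ[H]) ⊗≫ ((M ⊗ H) ◁ (β_ H H).hom ≫ r ▷ (H ⊗ H)) ▷ H ⊗≫
            r ▷ H ▷ H ⊗≫ s ▷ H ≫ s := by
        dsimp only [tensorμ]; monoidal
      _ = M ◁ (Δ[H] ⊗ₘ Δ[H]) ⊗≫ r ▷ ((H ⊗ H) ⊗ H) ⊗≫
            ((α_ _ _ _).hom ≫ M ◁ (β_ H H).hom ≫ (α_ _ _ _).inv ≫ r ▷ H ≫ s) ▷ H ≫ s := by
        rw [whisker_exchange]; monoidal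
      _ = M ◁ Δ[H] ▷ H ⊗≫ ((M ⊗ (H ⊗ H)) ◁ Δ[H] ≫ ((α_ _ _ _).inv ≫ r ▷ H ≫ s) ▷ (H ⊗ H)) ⊗≫
            r ▷ H ≫ s := by
        rw [← h, MonoidalCategory.tensorHom_def]; monoidal
      _ = _ := by
        rw [whisker_exchange]; monoidal

/-- Left action on `M ⊗ N`: `h · (m ⊗ n) = h₁ · m ⊗ h₂ · n`, where `h₂` passes `m` by the braiding
`(β_ H M).hom`. -/
def tensorActLeft {M N : C} (a : H ⊗ M ⟶ M) (b : H ⊗ N ⟶ N) : H ⊗ (M ⊗ N) ⟶ M ⊗ N :=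
  Δ[H] ▷ (M ⊗ N) ≫ tensorμ H H M N ≫ (a ⊗ₘ b)

/-- Right action on `M ⊗ N`: `(m ⊗ n) · h = m · h₁ ⊗ n · h₂`, where `n` passes `h₁` by the braiding
`(β_ N H).hom`. -/
def tensorActRight {M N : C} (a : M ⊗ H ⟶ M) (b : N ⊗ H ⟶ N) : (M ⊗ N) ⊗ H ⟶ M ⊗ N :=
  (M ⊗ N) ◁ Δ[H] ≫ tensorμ M N H H ≫ (a ⊗ₘ b)

theorem IsRightAction.tensor {M N : C} {a : M ⊗ H ⟶ M} {b : N ⊗ H ⟶ N} (ha : IsRightAction a) (hb : IsRightAction b) :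
    IsRightAction (tensorActRight a b) where
  one := by
    calc _ = (M ⊗ N) ◁ (η[H] ≫ Δ[H]) ≫ tensorμ M N H H ≫ (a ⊗ₘ b) := by
          simp only [tensorActRight, whiskerLeft_comp, Category.assoc]
      _ = (M ⊗ N) ◁ (λ_ (𝟙_ C)).inv ≫ tensorμ M N (𝟙_ C) (𝟙_ C) ≫ ((M ◁ η[H] ≫ a) ⊗ₘ (N ◁ η[H] ≫ b)) := by
        rw [Bimon.one_comul, whiskerLeft_comp_assoc, tensorμ_natural_right_assoc, tensorHom_comp_tensorHom]
      _ = _ := by rw [ha.one, hb.one, tensor_right_unitality]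
  mul := by
    calc _ = (M ⊗ N) ◁ (μ[H] ≫ Δ[H]) ≫ tensorμ M N H H ≫ (a ⊗ₘ b) := by
          simp only [tensorActRight, whiskerLeft_comp, Category.assoc]
      _ = (M ⊗ N) ◁ (Δ[H] ⊗ₘ Δ[H]) ≫ (M ⊗ N) ◁ tensorμ H H H H ≫ tensorμ M N _ _ ≫
            ((M ◁ μ[H] ≫ a) ⊗ₘ (N ◁ μ[H] ≫ b)) := by
        rw [BimonObj.mul_comul, whiskerLeft_comp_assoc, whiskerLeft_comp_assoc,
          tensorμ_natural_right_assoc, tensorHom_comp_tensorHom]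
      _ = (M ⊗ N) ◁ (Δ[H] ⊗ₘ Δ[H]) ≫ (α_ _ _ _).inv ≫ tensorμ M N H H ▷ (H ⊗ H) ≫
            (tensorμ (M ⊗ H) (N ⊗ H) H H) ≫ ((a ▷ H ≫ a) ⊗ₘ (b ▷ H ≫ b)) := by
        rw [ha.mul, hb.mul, ← tensorHom_comp_tensorHom]
        congr 1
        rw [Iso.eq_inv_comp, ← tensor_associativity_assoc, tensorHom_comp_tensorHom_assoc]
        simp
      _ = (M ⊗ N) ◁ Δ[H] ▷ H ≫ (α_ _ _ _).inv ≫ (((M ⊗ N) ⊗ (H ⊗ H)) ◁ Δ[H] ≫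
            (tensorμ M N H H ≫ (a ⊗ₘ b)) ▷ (H ⊗ H)) ≫ tensorμ M N H H ≫ (a ⊗ₘ b) := by
        rw [← tensorHom_comp_tensorHom, ← tensorμ_natural_left_assoc,
          MonoidalCategory.tensorHom_def Δ[H]]
        simp
      _ = _ := by
        rw [whisker_exchange]
        simp [tensorActRight]

/-- The trivial left action, through the counit. -/
def trivLeft (V : C) : H ⊗ V ⟶ V := ε[H] ▷ V ≫ (λ_ V).hom
/-- The trivial right action, through the counit. -/
def trivRight (V : C) : V ⊗ H ⟶ V := V ◁ ε[H] ≫ (ρ_ V).hom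

theorem tensorActLeft_natural {M N M' N' : C} {a : H ⊗ M ⟶ M} {b : H ⊗ N ⟶ N}
    {a' : H ⊗ M' ⟶ M'} {b' : H ⊗ N' ⟶ N'} {f : M ⟶ M'} {g : N ⟶ N'}
    (hf : a ≫ f = H ◁ f ≫ a') (hg : b ≫ g = H ◁ g ≫ b') :
    tensorActLeft a b ≫ (f ⊗ₘ g) = H ◁ (f ⊗ₘ g) ≫ tensorActLeft a' b' := by
  simp only [tensorActLeft, Category.assoc]
  rw [tensorHom_comp_tensorHom, hf, hg, ← tensorHom_comp_tensorHom, ← tensorμ_natural_right_assoc,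
    whisker_exchange_assoc]

theorem tensorActRight_natural {M N M' N' : C} {a : M ⊗ H ⟶ M} {b : N ⊗ H ⟶ N}
    {a' : M' ⊗ H ⟶ M'} {b' : N' ⊗ H ⟶ N'} {f : M ⟶ M'} {g : N ⟶ N'}
    (hf : a ≫ f = f ▷ H ≫ a') (hg : b ≫ g = g ▷ H ≫ b') :
    tensorActRight a b ≫ (f ⊗ₘ g) = (f ⊗ₘ g) ▷ H ≫ tensorActRight a' b' := by
  simp only [tensorActRight, Category.assoc]
  rw [tensorHom_comp_tensorHom, hf, hg, ← tensorHom_comp_tensorHom, ← tensorμ_natural_left_assoc,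
    ← whisker_exchange_assoc]

theorem tensorActLeft_assoc {M N P : C} (a : H ⊗ M ⟶ M) (b : H ⊗ N ⟶ N) (c : H ⊗ P ⟶ P) :
    tensorActLeft (tensorActLeft a b) c ≫ (α_ _ _ _).hom =
      H ◁ (α_ _ _ _).hom ≫ tensorActLeft a (tensorActLeft b c) := by
  calc _ = (Δ[H] ≫ Δ[H] ▷ H) ▷ _ ≫ tensorμ (H ⊗ H) H (M ⊗ N) P ≫ tensorμ H H M N ▷ (H ⊗ P) ≫
        ((a ⊗ₘ b) ⊗ₘ c) ≫ (α_ _ _ _).hom := by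
        have := tensorμ_natural_left Δ[H] (𝟙 H) (M ⊗ N) P
        simp only [tensorHom_id, id_whiskerRight] at this
        rw [comp_whiskerRight, Category.assoc, reassoc_of% this]
        simp [tensorActLeft, MonoidalCategory.tensorHom_def _ c]
    _ = (Δ[H] ≫ Δ[H] ▷ H ≫ (α_ _ _ _).hom) ▷ _ ≫ (H ⊗ H ⊗ H) ◁ (α_ _ _ _).hom ≫
        tensorμ _ _ _ _ ≫ (H ⊗ M) ◁ tensorμ H H N P ≫ (a ⊗ₘ (b ⊗ₘ c)) := by
        rw [associator_naturality, associator_monoidal_assoc]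
        simp [MonoidalCategory.tensorHom_def (α_ _ _ _).hom]
    _ = _ := by
        have := tensorμ_natural_left (𝟙 H) Δ[H] M (N ⊗ P)
        simp only [id_tensorHom, id_whiskerRight] at this
        rw [← ComonObj.comul_assoc, comp_whiskerRight, Category.assoc, ← whisker_exchange_assoc,
          reassoc_of% this, ← whisker_exchange_assoc]
        simp [tensorActLeft, MonoidalCategory.tensorHom_def' a]

theorem tensorActLeft_unit {M : C} (a : H ⊗ M ⟶ M) :
    tensorActLeft a (trivLeft (𝟙_ C)) ≫ (ρ_ M).hom = H ◁ (ρ_ M).hom ≫ a := by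
  have := tensorμ_natural_left (𝟙 H) ε[H] M (𝟙_ C)
  simp only [id_tensorHom, id_whiskerRight] at this
  calc _ = Δ[H] ▷ _ ≫ (tensorμ H H M (𝟙_ C) ≫ (H ⊗ M) ◁ ε[H] ▷ 𝟙_ C) ≫ (a ⊗ₘ (λ_ _).hom) ≫
        (ρ_ M).hom := by
        simp [tensorActLeft, trivLeft, MonoidalCategory.tensorHom_def' a]
    _ = (Δ[H] ≫ H ◁ ε[H]) ▷ _ ≫ tensorμ H (𝟙_ C) M (𝟙_ C) ≫ (a ⊗ₘ (λ_ _).hom) ≫ (ρ_ M).hom := by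
        rw [← this]; simp only [comp_whiskerRight, Category.assoc]
    _ = _ := by
        rw [ComonObj.comul_counit]
        simp [tensorμ, MonoidalCategory.tensorHom_def' a]
        monoidal
theorem tensorActLeft_unit' {M : C} (a : H ⊗ M ⟶ M) :
    tensorActLeft (trivLeft (𝟙_ C)) a ≫ (λ_ M).hom = H ◁ (λ_ M).hom ≫ a := by
  have := tensorμ_natural_left ε[H] (𝟙 H) (𝟙_ C) M
  simp only [tensorHom_id, id_whiskerRight] at this
  calc _ = Δ[H] ▷ _ ≫ (tensorμ H H (𝟙_ C) M ≫ (ε[H] ▷ 𝟙_ C) ▷ (H ⊗ M)) ≫ ((λ_ _).hom ⊗ₘ a) ≫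
        (λ_ M).hom := by
        simp only [tensorActLeft, trivLeft, MonoidalCategory.tensorHom_def _ a, comp_whiskerRight,
          Category.assoc]
    _ = (Δ[H] ≫ ε[H] ▷ H) ▷ _ ≫ tensorμ (𝟙_ C) H (𝟙_ C) M ≫ ((λ_ _).hom ⊗ₘ a) ≫ (λ_ M).hom := by
        rw [← this]; simp only [comp_whiskerRight, Category.assoc]
    _ = _ := by
        rw [ComonObj.counit_comul]
        simp [tensorμ, MonoidalCategory.tensorHom_def _ a]

theorem tensorActRight_assoc {M N P : C} (a : M ⊗ H ⟶ M) (b : N ⊗ H ⟶ N) (c : P ⊗ H ⟶ P) :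
    tensorActRight (tensorActRight a b) c ≫ (α_ _ _ _).hom =
      (α_ _ _ _).hom ▷ H ≫ tensorActRight a (tensorActRight b c) := by
  calc _ = _ ◁ (Δ[H] ≫ Δ[H] ▷ H) ≫ tensorμ (M ⊗ N) P (H ⊗ H) H ≫ tensorμ M N H H ▷ (P ⊗ H) ≫
        ((a ⊗ₘ b) ⊗ₘ c) ≫ (α_ _ _ _).hom := by
        have := tensorμ_natural_right (M ⊗ N) P Δ[H] (𝟙 H)
        simp only [tensorHom_id, whiskerLeft_id] at this
        rw [whiskerLeft_comp, Category.assoc, reassoc_of% this]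
        simp only [tensorActRight, MonoidalCategory.tensorHom_def _ c, comp_whiskerRight,
          Category.assoc]
    _ = _ ◁ (Δ[H] ≫ Δ[H] ▷ H ≫ (α_ _ _ _).hom) ≫ (α_ _ _ _).hom ▷ (H ⊗ H ⊗ H) ≫
        tensorμ _ _ _ _ ≫ (M ⊗ H) ◁ tensorμ N P H H ≫ (a ⊗ₘ (b ⊗ₘ c)) := by
        rw [associator_naturality, associator_monoidal_assoc]
        simp only [MonoidalCategory.tensorHom_def' (α_ _ _ _).hom, whiskerLeft_comp, Category.assoc]
    _ = _ := by
        have := tensorμ_natural_right M (N ⊗ P) (𝟙 H) Δ[H]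
        simp only [id_tensorHom, whiskerLeft_id] at this
        rw [← ComonObj.comul_assoc, whiskerLeft_comp, Category.assoc, whisker_exchange_assoc,
          reassoc_of% this, whisker_exchange_assoc]
        simp only [tensorActRight, MonoidalCategory.tensorHom_def' a, whiskerLeft_comp,
          Category.assoc]

theorem tensorActRight_unit {M : C} (a : M ⊗ H ⟶ M) :
    tensorActRight a (trivRight (𝟙_ C)) ≫ (ρ_ M).hom = (ρ_ M).hom ▷ H ≫ a := by
  have := tensorμ_natural_right M (𝟙_ C) (𝟙 H) ε[H]
  simp only [id_tensorHom, whiskerLeft_id] at this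
  calc _ = _ ◁ Δ[H] ≫ (tensorμ M (𝟙_ C) H H ≫ (M ⊗ H) ◁ 𝟙_ C ◁ ε[H]) ≫ (a ⊗ₘ (ρ_ _).hom) ≫
        (ρ_ M).hom := by
        simp only [tensorActRight, trivRight, MonoidalCategory.tensorHom_def' a, whiskerLeft_comp,
          Category.assoc]
    _ = _ ◁ (Δ[H] ≫ H ◁ ε[H]) ≫ tensorμ M (𝟙_ C) H (𝟙_ C) ≫ (a ⊗ₘ (ρ_ _).hom) ≫ (ρ_ M).hom := by
        rw [← this]; simp only [whiskerLeft_comp, Category.assoc]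
    _ = _ := by
        rw [ComonObj.comul_counit]
        simp [tensorμ, MonoidalCategory.tensorHom_def' a]

theorem tensorActRight_unit' {M : C} (a : M ⊗ H ⟶ M) :
    tensorActRight (trivRight (𝟙_ C)) a ≫ (λ_ M).hom = (λ_ M).hom ▷ H ≫ a := by
  have := tensorμ_natural_right (𝟙_ C) M ε[H] (𝟙 H)
  simp only [tensorHom_id, whiskerLeft_id] at this
  calc _ = _ ◁ Δ[H] ≫ (tensorμ (𝟙_ C) M H H ≫ (𝟙_ C ◁ ε[H]) ▷ (M ⊗ H)) ≫ ((ρ_ _).hom ⊗ₘ a) ≫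
        (λ_ M).hom := by
        simp only [tensorActRight, trivRight, MonoidalCategory.tensorHom_def _ a, comp_whiskerRight,
          Category.assoc]
    _ = _ ◁ (Δ[H] ≫ ε[H] ▷ H) ≫ tensorμ (𝟙_ C) M (𝟙_ C) H ≫ ((ρ_ _).hom ⊗ₘ a) ≫ (λ_ M).hom := by
        rw [← this]; simp only [whiskerLeft_comp, Category.assoc]
    _ = _ := by
        rw [ComonObj.counit_comul]
        simp [tensorμ, MonoidalCategory.tensorHom_def _ a]
        monoidal

section
variable {M : C} [HasRightDual M]

/-- Symbolically `(h · f)(m) = f(S(h) · m)`, with `h` passing `f` by `(β_ H Mᘁ).hom`. -/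
noncomputable def dualActLeft (a : H ⊗ M ⟶ M) : H ⊗ Mᘁ ⟶ Mᘁ :=
  (β_ H Mᘁ).hom ≫ Mᘁ ◁ 𝒮[H] ≫ dualOp a

/-- Symbolically `(f · h)(m) = f(m · S⁻¹(h))`, with `h` passing `m` by `(β_ M H).inv`. -/
noncomputable def dualActRight [IsIso 𝒮[H]] (c : M ⊗ H ⟶ M) : Mᘁ ⊗ H ⟶ Mᘁ :=
  dualOp ((β_ M H).inv ≫ M ◁ inv 𝒮[H] ≫ c)

theorem dualActLeft_ev (a : H ⊗ M ⟶ M) : dualActLeft a ▷ M ≫ ε_ M Mᘁ =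
    (β_ H Mᘁ).hom ▷ M ≫ (α_ _ _ _).hom ≫ (Mᘁ : C) ◁ (𝒮[H] ▷ M ≫ a) ≫ ε_ M Mᘁ := by
  simp only [dualActLeft, comp_whiskerRight, Category.assoc, dualOp_ev]
  simp

theorem ev_left {a : H ⊗ M ⟶ M} (ha : IsLeftAction a) :
    tensorActLeft (dualActLeft a) a ≫ ε_ M Mᘁ = H ◁ ε_ M Mᘁ ≫ trivLeft (𝟙_ C) := by
  calc _ = Δ[H] ▷ (Mᘁ ⊗ M) ≫ tensorμ H H Mᘁ M ≫ (H ⊗ Mᘁ : C) ◁ a ≫ dualActLeft a ▷ M ≫ ε_ M Mᘁ := by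
        simp only [tensorActLeft, MonoidalCategory.tensorHom_def', Category.assoc]
    _ = (α_ _ _ _).inv ≫ (Δ[H] ▷ Mᘁ ≫ (β_ (H ⊗ H) Mᘁ).hom) ▷ M ≫ (α_ _ _ _).hom ≫
         (Mᘁ : C) ◁ (𝒮[H] ▷ H ▷ M) ≫ (Mᘁ : C) ◁ ((α_ _ _ _).hom ≫ H ◁ a ≫ a) ≫ ε_ M Mᘁ := by
        rw [dualActLeft_ev, whisker_exchange_assoc]
        calc _ = (α_ _ _ _).inv ≫ (Δ[H] ▷ Mᘁ ≫ (β_ (H ⊗ H) Mᘁ).hom) ▷ M ⊗≫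
              (Mᘁ : C) ◁ (H ◁ a ≫ 𝒮[H] ▷ M) ⊗≫ (Mᘁ : C) ◁ a ≫ ε_ M Mᘁ := by
              rw [BraidedCategory.braiding_tensor_left_hom]
              dsimp only [tensorμ]
              monoidal
          _ = _ := by
              rw [whisker_exchange]
              monoidal
    _ = (α_ _ _ _).inv ≫ (β_ H Mᘁ).hom ▷ M ≫ (α_ _ _ _).hom ≫
         (Mᘁ : C) ◁ ((Δ[H] ≫ 𝒮[H] ▷ H ≫ μ[H]) ▷ M ≫ a) ≫ ε_ M Mᘁ := by
        rw [← ha.mul, BraidedCategory.braiding_naturality_left]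
        simp only [comp_whiskerRight, whiskerLeft_comp, Category.assoc, whisker_assoc, Iso.inv_hom_id_assoc]
    _ = (α_ _ _ _).inv ≫ (β_ H Mᘁ).hom ▷ M ≫ (α_ _ _ _).hom ≫
         (Mᘁ : C) ◁ (ε[H] ▷ M ≫ η[H] ▷ M ≫ a) ≫ ε_ M Mᘁ := by
        rw [HopfObj.antipode_left, comp_whiskerRight, Category.assoc]
    _ = (α_ _ _ _).inv ≫ ((β_ H Mᘁ).hom ≫ (Mᘁ : C) ◁ ε[H]) ▷ M ≫ (α_ _ _ _).hom ≫
         (Mᘁ : C) ◁ (λ_ M).hom ≫ ε_ M Mᘁ := by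
        rw [ha.one]; simp
    _ = _ := by
        rw [← BraidedCategory.braiding_naturality_left, braiding_tensorUnit_left]
        calc _ = 𝟙 _ ⊗≫ (ε[H] ▷ (Mᘁ ⊗ M) ≫ 𝟙_ C ◁ ε_ M Mᘁ) ⊗≫ 𝟙 _ := by monoidal
          _ = _ := by rw [← whisker_exchange, trivLeft]; monoidal

theorem ev_right [IsIso 𝒮[H]] {c : M ⊗ H ⟶ M} (hc : IsRightAction c) :
    tensorActRight (dualActRight c) c ≫ ε_ M Mᘁ = ε_ M Mᘁ ▷ H ≫ trivRight (𝟙_ C) := by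
  have e₁ : (β_ M H).hom ▷ H ≫ (α_ _ _ _).hom ≫ H ◁ c ≫ (β_ M H).inv =
      (α_ _ _ _).hom ≫ M ◁ (β_ H H).inv ≫ (α_ _ _ _).inv ≫ c ▷ H := by
    rw [BraidedCategory.braiding_inv_naturality_right]
    simp
  have e₂ : M ◁ (β_ H H).inv ≫ (α_ _ _ _).inv ≫ c ▷ H ≫ M ◁ inv 𝒮[H] ≫ c =
      M ◁ (inv 𝒮[H] ▷ H ≫ (β_ H H).inv ≫ μ[H]) ≫ c := by
    rw [← whisker_exchange_assoc, BraidedCategory.braiding_inv_naturality_left_assoc,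
      whiskerLeft_comp_assoc, whiskerLeft_comp_assoc, hc.mul]
    simp
  calc _ = (Mᘁ ⊗ M) ◁ Δ[H] ≫ tensorμ Mᘁ M H H ≫ (Mᘁ ⊗ H : C) ◁ c ≫ dualActRight c ▷ M ≫ ε_ M Mᘁ := by
        simp only [tensorActRight, MonoidalCategory.tensorHom_def', Category.assoc]
    _ = (α_ _ _ _).hom ≫ (Mᘁ : C) ◁ (M ◁ Δ[H] ≫ (α_ _ _ _).inv ≫ (β_ M H).hom ▷ H ≫ (α_ _ _ _).hom ≫
          H ◁ c ≫ (β_ M H).inv ≫ M ◁ inv 𝒮[H] ≫ c) ≫ ε_ M Mᘁ := by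
        rw [dualActRight, dualOp_ev]
        dsimp only [tensorμ]
        monoidal
    _ = (α_ _ _ _).hom ≫ (Mᘁ : C) ◁ (M ◁ (Δ[H] ≫ (inv 𝒮[H]) ▷ H ≫ (β_ H H).inv ≫ μ[H]) ≫ c) ≫ ε_ M Mᘁ := by
        rw [reassoc_of% e₁, Iso.inv_hom_id_assoc, e₂, ← whiskerLeft_comp_assoc]
    _ = (α_ _ _ _).hom ≫ (Mᘁ : C) ◁ (M ◁ ε[H] ≫ M ◁ η[H] ≫ c) ≫ ε_ M Mᘁ := by
        rw [inv_antipode_op']; simp only [whiskerLeft_comp, Category.assoc]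
    _ = _ := by
        rw [hc.one]
        calc _ = 𝟙 _ ⊗≫ (((Mᘁ : C) ⊗ M) ◁ ε[H] ≫ ε_ M Mᘁ ▷ 𝟙_ C) ⊗≫ 𝟙 _ := by monoidal
          _ = _ := by rw [whisker_exchange, trivRight]; monoidal

theorem coev_left {a : H ⊗ M ⟶ M} (ha : IsLeftAction a) :
    trivLeft (𝟙_ C) ≫ η_ M Mᘁ = H ◁ η_ M Mᘁ ≫ tensorActLeft a (dualActLeft a) := by
  symm
  calc _ = (H ◁ η_ M Mᘁ ≫ Δ[H] ▷ (M ⊗ Mᘁ)) ≫ tensorμ H H M Mᘁ ≫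
            (H ⊗ M) ◁ dualActLeft a ≫ a ▷ (Mᘁ : C) := by
        simp only [tensorActLeft, MonoidalCategory.tensorHom_def', Category.assoc]
    _ = 𝟙 _ ⊗≫ Δ[H] ⊗≫ H ◁ (H ◁ η_ M Mᘁ ≫ (β_ H (M ⊗ Mᘁ)).hom) ⊗≫
          H ◁ M ◁ ((Mᘁ : C) ◁ 𝒮[H] ≫ dualOp a) ⊗≫ a ▷ (Mᘁ : C) := by
        rw [whisker_exchange, dualActLeft, BraidedCategory.braiding_tensor_right_hom]
        dsimp only [tensorμ]
        monoidal
    _ = 𝟙 _ ⊗≫ Δ[H] ⊗≫ H ◁ (η_ M Mᘁ ▷ H ≫ (M ⊗ Mᘁ) ◁ 𝒮[H]) ⊗≫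
          H ◁ M ◁ dualOp a ⊗≫ a ▷ (Mᘁ : C) := by
        rw [BraidedCategory.braiding_naturality_right, braiding_tensorUnit_right]
        monoidal
    _ = 𝟙 _ ⊗≫ (Δ[H] ≫ H ◁ 𝒮[H]) ⊗≫ H ◁ (η_ M Mᘁ ▷ H ≫ (α_ _ _ _).hom ≫ M ◁ dualOp a) ⊗≫
          a ▷ (Mᘁ : C) := by
        rw [← whisker_exchange]
        monoidal
    _ = 𝟙 _ ⊗≫ (Δ[H] ≫ H ◁ 𝒮[H]) ⊗≫ (H ⊗ H) ◁ η_ M Mᘁ ⊗≫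
          ((α_ _ _ _).hom ≫ H ◁ a ≫ a) ▷ (Mᘁ : C) := by
        rw [coev_dualOp]
        monoidal
    _ = 𝟙 _ ⊗≫ (Δ[H] ≫ H ◁ 𝒮[H]) ⊗≫ ((H ⊗ H) ◁ η_ M Mᘁ ≫ μ[H] ▷ (M ⊗ Mᘁ)) ⊗≫ a ▷ (Mᘁ : C) := by
        rw [← ha.mul]
        monoidal
    _ = 𝟙 _ ⊗≫ (Δ[H] ≫ H ◁ 𝒮[H] ≫ μ[H]) ▷ 𝟙_ C ≫ H ◁ η_ M Mᘁ ⊗≫ a ▷ (Mᘁ : C) := by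
        rw [whisker_exchange]
        monoidal
    _ = 𝟙 _ ⊗≫ ε[H] ⊗≫ (η[H] ▷ 𝟙_ C ≫ H ◁ η_ M Mᘁ) ⊗≫ a ▷ (Mᘁ : C) := by
        rw [HopfObj.antipode_right]
        monoidal
    _ = 𝟙 _ ⊗≫ ε[H] ⊗≫ η_ M Mᘁ ⊗≫ (η[H] ▷ M ≫ a) ▷ (Mᘁ : C) := by
        rw [← whisker_exchange]
        monoidal
    _ = _ := by
        rw [ha.one, trivLeft]
        monoidal

theorem coev_right [IsIso 𝒮[H]] {c : M ⊗ H ⟶ M} (hc : IsRightAction c) :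
    trivRight (𝟙_ C) ≫ η_ M Mᘁ = η_ M Mᘁ ▷ H ≫ tensorActRight c (dualActRight c) := by
  have e₁ : η_ M Mᘁ ▷ H ≫ (α_ _ _ _).hom ≫ M ◁ (β_ (Mᘁ : C) H).hom =
      (λ_ H).hom ≫ (ρ_ H).inv ≫ H ◁ η_ M Mᘁ ≫ (α_ _ _ _).inv ≫ (β_ M H).inv ▷ (Mᘁ : C) ≫
        (α_ _ _ _).hom := by
    have := BraidedCategory.braiding_naturality_left (η_ M Mᘁ) H
    rw [braiding_tensorUnit_left, BraidedCategory.braiding_tensor_left_hom] at this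
    rw [Category.assoc] at this
    rw [← reassoc_of% this]
    simp
  have e₂ : H ◁ ((β_ M H).inv ≫ M ◁ inv 𝒮[H] ≫ c) ≫ (β_ M H).inv ≫ c =
      (α_ _ _ _).inv ≫ (H ◁ inv 𝒮[H] ≫ (β_ H H).inv ≫ μ[H]) ▷ M ≫ (β_ M H).inv ≫ c := by
    calc _ = H ◁ (β_ M H).inv ≫ (H ◁ (M ◁ inv 𝒮[H] ≫ c) ≫ (β_ M H).inv) ≫ c := by
          simp only [whiskerLeft_comp, Category.assoc]
      _ = (α_ _ _ _).inv ≫ (β_ M (H ⊗ H)).inv ≫ M ◁ (β_ H H).inv ≫ M ◁ (inv 𝒮[H] ▷ H) ≫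
            M ◁ μ[H] ≫ c := by
          rw [BraidedCategory.braiding_inv_naturality_right, hc.mul]
          simp
      _ = _ := by
          rw [BraidedCategory.braiding_inv_naturality_left_assoc,
            BraidedCategory.braiding_inv_naturality_right_assoc]
          simp only [whiskerLeft_comp, Category.assoc]
  symm
  calc _ = (η_ M Mᘁ ▷ H ≫ (M ⊗ Mᘁ) ◁ Δ[H]) ≫ tensorμ M Mᘁ H H ≫
            (M ⊗ H) ◁ dualActRight c ≫ c ▷ (Mᘁ : C) := by
        simp only [tensorActRight, MonoidalCategory.tensorHom_def', Category.assoc]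
    _ = 𝟙 _ ⊗≫ Δ[H] ⊗≫ (η_ M Mᘁ ▷ H ≫ (α_ _ _ _).hom ≫ M ◁ (β_ (Mᘁ : C) H).hom) ▷ H ⊗≫
          (M ⊗ H) ◁ dualActRight c ≫ c ▷ (Mᘁ : C) := by
        rw [← whisker_exchange]
        dsimp only [tensorμ]
        monoidal
    _ = 𝟙 _ ⊗≫ Δ[H] ⊗≫ H ◁ η_ M Mᘁ ▷ H ⊗≫
          ((β_ M H).inv ▷ (Mᘁ ⊗ H) ≫ (M ⊗ H) ◁ dualActRight c) ≫ c ▷ (Mᘁ : C) := by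
        rw [e₁]
        monoidal
    _ = 𝟙 _ ⊗≫ Δ[H] ⊗≫ H ◁ (η_ M Mᘁ ▷ H ≫ (α_ _ _ _).hom ≫ M ◁ dualActRight c) ⊗≫
          ((β_ M H).inv ≫ c) ▷ (Mᘁ : C) := by
        rw [← whisker_exchange]
        monoidal
    _ = 𝟙 _ ⊗≫ Δ[H] ⊗≫ (H ⊗ H) ◁ η_ M Mᘁ ⊗≫
          (H ◁ ((β_ M H).inv ≫ M ◁ inv 𝒮[H] ≫ c) ≫ (β_ M H).inv ≫ c) ▷ (Mᘁ : C) := by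
        rw [dualActRight, coev_dualOp]
        monoidal
    _ = 𝟙 _ ⊗≫ Δ[H] ⊗≫ ((H ⊗ H) ◁ η_ M Mᘁ ≫
          (H ◁ inv 𝒮[H] ≫ (β_ H H).inv ≫ μ[H]) ▷ (M ⊗ Mᘁ)) ⊗≫ ((β_ M H).inv ≫ c) ▷ (Mᘁ : C) := by
        rw [e₂]
        monoidal
    _ = 𝟙 _ ⊗≫ (Δ[H] ≫ H ◁ inv 𝒮[H] ≫ (β_ H H).inv ≫ μ[H]) ▷ 𝟙_ C ≫ H ◁ η_ M Mᘁ ⊗≫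
          ((β_ M H).inv ≫ c) ▷ (Mᘁ : C) := by
        rw [whisker_exchange]
        monoidal
    _ = 𝟙 _ ⊗≫ ε[H] ⊗≫ (η[H] ▷ 𝟙_ C ≫ H ◁ η_ M Mᘁ) ⊗≫ ((β_ M H).inv ≫ c) ▷ (Mᘁ : C) := by
        rw [inv_antipode_op]
        monoidal
    _ = 𝟙 _ ⊗≫ ε[H] ⊗≫ η_ M Mᘁ ⊗≫ (η[H] ▷ M ≫ (β_ M H).inv ≫ c) ▷ (Mᘁ : C) := by
        rw [← whisker_exchange]
        monoidal
    _ = _ := by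
        rw [BraidedCategory.braiding_inv_naturality_left_assoc, hc.one, braiding_inv_tensorUnit_right,
          trivRight]
        monoidal
end

theorem pi_left {M : C} {a : H ⊗ M ⟶ M} {δ : M ⟶ H ⊗ M} (ha : IsLeftAction a)
    (h : a ≫ δ = H ◁ δ ≫ tensorActLeft μ[H] a) :
    a ≫ δ ≫ 𝒮[H] ▷ M ≫ a = ε[H] ▷ M ≫ (λ_ M).hom ≫ δ ≫ 𝒮[H] ▷ M ≫ a := by
  have hm : ∀ (X : C) (f : X ⟶ H ⊗ (H ⊗ M)), f ≫ H ◁ a ≫ a = f ≫ (α_ _ _ _).inv ≫ μ[H] ▷ M ≫ a := by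
    intro X f; rw [ha.mul]; simp
  calc _ = H ◁ δ ≫ Δ[H] ▷ _ ≫ tensorμ H H H M ≫ (H ⊗ H) ◁ a ≫ (μ[H] ≫ 𝒮[H]) ▷ M ≫ a := by
        rw [reassoc_of% h]
        simp only [tensorActLeft, MonoidalCategory.tensorHom_def', Category.assoc, comp_whiskerRight]
    _ = H ◁ δ ≫ Δ[H] ▷ _ ≫ tensorμ H H H M ≫
          ((H ⊗ H) ◁ a ≫ ((𝒮[H] ⊗ₘ 𝒮[H]) ≫ (β_ H H).hom) ▷ M) ≫ (α_ _ _ _).hom ≫ H ◁ a ≫ a := by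
        rw [HopfObj.mul_antipode, ← ha.mul]
        simp only [Category.assoc, comp_whiskerRight]
    _ = H ◁ δ ⊗≫ (Δ[H] ▷ H ≫ (β_ (H ⊗ H) H).hom) ▷ M ⊗≫ (𝒮[H] ▷ (H ⊗ H) ≫ H ◁ 𝒮[H] ▷ H) ▷ M ⊗≫
          H ◁ ((α_ _ _ _).hom ≫ H ◁ a ≫ a) ≫ a := by
        rw [whisker_exchange, BraidedCategory.braiding_naturality,
          BraidedCategory.braiding_tensor_left_hom, MonoidalCategory.tensorHom_def 𝒮[H] 𝒮[H]]
        dsimp only [tensorμ]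
        monoidal
    _ = H ◁ δ ⊗≫ (β_ H H).hom ▷ M ⊗≫ (H ◁ Δ[H] ≫ 𝒮[H] ▷ (H ⊗ H)) ▷ M ⊗≫
          H ◁ ((𝒮[H] ▷ H ≫ μ[H]) ▷ M ≫ a) ≫ a := by
        rw [BraidedCategory.braiding_naturality_left, ← ha.mul]
        monoidal
    _ = H ◁ δ ⊗≫ ((β_ H H).hom ≫ 𝒮[H] ▷ H) ▷ M ⊗≫
          H ◁ ((Δ[H] ≫ 𝒮[H] ▷ H ≫ μ[H]) ▷ M ≫ a) ≫ a := by
        rw [whisker_exchange]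
        monoidal
    _ = H ◁ δ ⊗≫ ((β_ H H).hom ≫ (𝒮[H] ▷ H ≫ H ◁ ε[H])) ▷ M ⊗≫ H ◁ (η[H] ▷ M ≫ a) ≫ a := by
        rw [HopfObj.antipode_left]
        monoidal
    _ = H ◁ δ ⊗≫ ε[H] ▷ (H ⊗ M) ⊗≫ 𝒮[H] ▷ M ≫ a := by
        rw [← whisker_exchange, ← BraidedCategory.braiding_naturality_left_assoc,
          braiding_tensorUnit_left, ha.one]
        monoidal
    _ = (H ◁ δ ≫ ε[H] ▷ (H ⊗ M)) ⊗≫ 𝒮[H] ▷ M ≫ a := by monoidal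
    _ = _ := by
        rw [whisker_exchange]
        monoidal

/-- The adjoint action `▷ ∘ (S ⊗ ◁) ∘ (β_{M,H} ⊗ id) ∘ (id ⊗ Δ)`. -/
def adAct {M : C} (a : H ⊗ M ⟶ M) (c : M ⊗ H ⟶ M) : M ⊗ H ⟶ M :=
  M ◁ Δ[H] ≫ (α_ _ _ _).inv ≫ (β_ M H).hom ▷ H ≫ (α_ _ _ _).hom ≫ (𝒮[H] ⊗ₘ c) ≫ a

theorem pi_right {M : C} {a : H ⊗ M ⟶ M} {c : M ⊗ H ⟶ M} {δ : M ⟶ H ⊗ M} (ha : IsLeftAction a)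
    (hac : a ▷ H ≫ c = (α_ _ _ _).hom ≫ H ◁ c ≫ a)
    (h : c ≫ δ = δ ▷ H ≫ tensorActRight μ[H] c) :
    c ≫ δ ≫ 𝒮[H] ▷ M ≫ a = (δ ≫ 𝒮[H] ▷ M ≫ a) ▷ H ≫ adAct a c := by
  calc _ = δ ▷ H ≫ _ ◁ Δ[H] ≫ tensorμ H M H H ≫ (H ⊗ H) ◁ c ≫ (μ[H] ≫ 𝒮[H]) ▷ M ≫ a := by
        rw [reassoc_of% h]
        simp only [tensorActRight, MonoidalCategory.tensorHom_def', Category.assoc, comp_whiskerRight]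
    _ = δ ▷ H ≫ _ ◁ Δ[H] ≫ tensorμ H M H H ≫
          ((H ⊗ H) ◁ c ≫ ((𝒮[H] ⊗ₘ 𝒮[H]) ≫ (β_ H H).hom) ▷ M) ≫ (α_ _ _ _).hom ≫ H ◁ a ≫ a := by
        rw [HopfObj.mul_antipode, ← ha.mul]
        simp only [Category.assoc, comp_whiskerRight]
    _ = (δ ▷ H ≫ _ ◁ Δ[H]) ⊗≫ (β_ (H ⊗ M) H).hom ▷ H ⊗≫ H ◁ 𝒮[H] ▷ M ▷ H ⊗≫
          𝒮[H] ▷ (H ⊗ M ⊗ H) ⊗≫ H ◁ (H ◁ c ≫ a) ≫ a := by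
        rw [whisker_exchange, BraidedCategory.braiding_naturality,
          BraidedCategory.braiding_tensor_left_hom, MonoidalCategory.tensorHom_def' 𝒮[H] 𝒮[H]]
        dsimp only [tensorμ]
        monoidal
    _ = M ◁ Δ[H] ⊗≫ δ ▷ (H ⊗ H) ⊗≫ ((β_ (H ⊗ M) H).hom ≫ H ◁ (𝒮[H] ▷ M)) ▷ H ⊗≫
          (𝒮[H] ▷ (H ⊗ M) ≫ H ◁ a) ▷ H ⊗≫ H ◁ c ≫ a := by
        rw [← whisker_exchange]
        have : H ◁ (H ◁ c ≫ a) = H ◁ ((α_ _ _ _).inv ≫ a ▷ H ≫ c) := by rw [hac]; simp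
        rw [this]
        monoidal
    _ = M ◁ Δ[H] ⊗≫ ((δ ≫ 𝒮[H] ▷ M) ▷ H ≫ (β_ (H ⊗ M) H).hom ≫ H ◁ a) ▷ H ⊗≫
          𝒮[H] ▷ (M ⊗ H) ≫ H ◁ c ≫ a := by
        rw [← whisker_exchange, ← BraidedCategory.braiding_naturality_left]
        monoidal
    _ = (M ◁ Δ[H] ≫ (δ ≫ 𝒮[H] ▷ M ≫ a) ▷ (H ⊗ H)) ⊗≫ (β_ M H).hom ▷ H ⊗≫
          𝒮[H] ▷ (M ⊗ H) ≫ H ◁ c ≫ a := by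
        rw [← BraidedCategory.braiding_naturality_left]
        monoidal
    _ = _ := by
        rw [whisker_exchange, adAct, MonoidalCategory.tensorHom_def]
        monoidal

theorem adAct_isRight {M : C} {a : H ⊗ M ⟶ M} {c : M ⊗ H ⟶ M} (ha : IsLeftAction a) (hc : IsRightAction c)
    (hac : a ▷ H ≫ c = (α_ _ _ _).hom ≫ H ◁ c ≫ a) : IsRightAction (adAct a c) := by
  have e : adAct a c = M ◁ Δ[H] ≫ (α_ _ _ _).inv ≫ ((β_ M H).hom ≫ 𝒮[H] ▷ M ≫ a) ▷ H ≫ c := by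
    simp only [comp_whiskerRight, Category.assoc, hac, adAct, MonoidalCategory.tensorHom_def]
    simp
  rw [e]
  refine combine ha.toRight hc ?_
  rw [BraidedCategory.braiding_naturality_left_assoc, whisker_exchange_assoc]
  have : H ◁ c ≫ a = (α_ _ _ _).inv ≫ a ▷ H ≫ c := by rw [hac]; simp
  rw [this]
  simp

/-- Right modules in `C` over the algebra `H`. -/
structure RightMod (H : C) [MonObj H] where
  X : C
  act : X ⊗ H ⟶ X
  isRight : IsRightAction act

namespace RightMod
variable {H : C}

@[ext]
structure Hom [MonObj H] (M N : RightMod H) where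
  hom : M.X ⟶ N.X
  act_hom : M.act ≫ hom = hom ▷ H ≫ N.act

instance [MonObj H] : Category (RightMod H) where
  Hom M N := Hom M N
  id M := ⟨𝟙 M.X, by simp⟩
  comp f g := ⟨f.hom ≫ g.hom, by
    rw [← Category.assoc, f.act_hom, Category.assoc, g.act_hom, comp_whiskerRight, Category.assoc]⟩

/-- Tensor product of right modules over a Hopf algebra. -/
def tensor [HopfObj H] (M N : RightMod H) : RightMod H where
  X := M.X ⊗ N.X
  act := tensorActRight M.act N.act
  isRight := M.isRight.tensor N.isRight

/-- An algebra morphism `χ : H ⟶ 𝟙_ C` as a right module with underlying object `𝟙_ C`. -/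
def ofCharacter [MonObj H] (χ : H ⟶ 𝟙_ C) [IsMonHom χ] : RightMod H where
  X := 𝟙_ C
  act := (λ_ H).hom ≫ χ
  isRight :=
    { one := by
        rw [leftUnitor_naturality_assoc, IsMonHom.one_hom]
        simp [unitors_equal]
      mul := by
        rw [leftUnitor_naturality_assoc, IsMonHom.mul_hom]
        simp [MonoidalCategory.tensorHom_def] }

variable (H) in
/-- An object of `C` as a right module through the counit of `H`. -/
def trivial [HopfObj H] (V : C) : RightMod H where
  X := V
  act := trivRight V
  isRight :=
    { one := by
        rw [trivRight, ← whiskerLeft_comp_assoc, BimonObj.one_counit]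
        simp
      mul := by
        rw [trivRight, ← whiskerLeft_comp_assoc, Bimon.mul_counit]
        simp [MonoidalCategory.tensorHom_def] }

end RightMod

/-- Hopf bimodules: left `H`-comodules in the monoidal category of `H`-bimodules, i.e. bimodules
with a left coaction which is a morphism of left and of right modules into `H ⊗ X`, where `H` is the
regular bimodule. -/
structure HopfBimod (H : C) [HopfObj H] extends Bimod (Mon.mk H) (Mon.mk H) where
  coact : X ⟶ H ⊗ X
  coact_counit : coact ≫ ε[H] ▷ X = (λ_ X).inv
  coact_coassoc : coact ≫ H ◁ coact = coact ≫ Δ[H] ▷ X ≫ (α_ H H X).hom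
  actLeft_coact : actLeft ≫ coact = H ◁ coact ≫ tensorActLeft μ[H] actLeft
  actRight_coact : actRight ≫ coact = coact ▷ H ≫ tensorActRight μ[H] actRight

section
variable (M : Bimod (Mon.mk H) (Mon.mk H))

theorem isLeft_actLeft : IsLeftAction (H := H) M.actLeft := ⟨M.one_actLeft, M.left_assoc⟩
theorem isRight_actRight : IsRightAction (H := H) M.actRight := ⟨M.actRight_one, M.right_assoc⟩

/-- The dual bimodule `M^∨` on the object `M^*`. By `ev_left`, `ev_right`, `coev_left` and
`coev_right`, the evaluation `M^∨ ⊗ M ⟶ 𝟙_ C` and the coevaluation `𝟙_ C ⟶ M ⊗ M^∨` are morphisms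
of bimodules, so this is the dual of `M` in the monoidal category of bimodules. -/
noncomputable def dualBimod [HasRightDual M.X] [IsIso 𝒮[H]] : Bimod (Mon.mk H) (Mon.mk H) where
  X := (M.X)ᘁ
  actLeft := dualActLeft (H := H) M.actLeft
  one_actLeft := (isLeft_actLeft M).dual.toLeft.one
  left_assoc := (isLeft_actLeft M).dual.toLeft.mul
  actRight := dualActRight (H := H) M.actRight
  actRight_one := (isRight_actRight M).toLeft'.dual.one
  right_assoc := (isRight_actRight M).toLeft'.dual.mul
  middle_assoc := by
    have e : dualActLeft (H := H) M.actLeft =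
        (β_ H (M.X)ᘁ).hom ≫ dualOp (𝒮[H] ▷ M.X ≫ M.actLeft) := by
      apply dual_hom_ext
      rw [dualActLeft_ev, comp_whiskerRight, Category.assoc, dualOp_ev]
    dsimp only
    rw [e]
    refine dual_middle ?_
    refine swap_twist (inv 𝒮[H]) ?_
    have := M.middle_assoc
    dsimp only at this
    rw [comp_whiskerRight, Category.assoc, this]
    rw [associator_naturality_left_assoc, ← whisker_exchange_assoc]
end

namespace HopfBimod
variable (M : HopfBimod H)

/-- The morphism `▷ ∘ (S ⊗ id) ∘ δ`. -/
def proj : M.X ⟶ M.X := M.coact ≫ 𝒮[H] ▷ M.X ≫ M.actLeft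


abbrev adAction : M.X ⊗ H ⟶ M.X := adAct M.actLeft M.actRight

theorem isRight_adAction : IsRightAction M.adAction :=
  adAct_isRight (isLeft_actLeft M.toBimod) (isRight_actRight M.toBimod) M.middle_assoc

/-- The right module of the adjoint action. -/
def ad : RightMod H where
  X := M.X
  act := M.adAction
  isRight := M.isRight_adAction

theorem ad_proj : M.adAction ≫ M.proj = M.proj ▷ H ≫ M.adAction := by
  have h₁ := pi_left (isLeft_actLeft M.toBimod) M.actLeft_coact
  have h₂ := pi_right (isLeft_actLeft M.toBimod) M.middle_assoc M.actRight_coact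
  calc _ = M.X ◁ Δ[H] ≫ (α_ _ _ _).inv ≫ (β_ M.X H).hom ▷ H ≫ (α_ _ _ _).hom ≫
        (𝒮[H] ⊗ₘ M.actRight) ≫ M.actLeft ≫ M.proj := by
        simp only [adAct, Category.assoc]
    _ = M.X ◁ Δ[H] ≫ (α_ _ _ _).inv ≫ (β_ M.X H).hom ▷ H ≫ (α_ _ _ _).hom ≫
        (𝒮[H] ⊗ₘ M.actRight) ≫ ε[H] ▷ M.X ≫ (λ_ M.X).hom ≫ M.proj := by
        rw [proj, h₁]
    _ = M.X ◁ Δ[H] ≫ (α_ _ _ _).inv ≫ ((β_ M.X H).hom ≫ ε[H] ▷ M.X) ▷ H ≫ (α_ _ _ _).hom ≫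
        (λ_ _).hom ≫ M.actRight ≫ M.proj := by
        rw [MonoidalCategory.tensorHom_def', Category.assoc, ← comp_whiskerRight_assoc,
          HopfObj.antipode_counit]
        simp [whisker_exchange_assoc]
    _ = M.X ◁ (Δ[H] ≫ ε[H] ▷ H) ≫ M.X ◁ (λ_ H).hom ≫ M.actRight ≫ M.proj := by
        rw [← BraidedCategory.braiding_naturality_right, braiding_tensorUnit_right,
          whiskerLeft_comp]
        monoidal
    _ = _ := by
        rw [ComonObj.counit_comul, proj, h₂]
        simp

variable [HasEqualizers C]

/-- The object of coinvariants: the equalizer of `▷ ∘ (S ⊗ id) ∘ δ` and the identity. -/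
noncomputable abbrev coinvObj : C := equalizer M.proj (𝟙 M.X)

noncomputable abbrev coinvι : M.coinvObj ⟶ M.X := equalizer.ι M.proj (𝟙 M.X)

theorem coinvι_proj : M.coinvι ≫ M.proj = M.coinvι := by
  rw [equalizer.condition, Category.comp_id]

/-- The adjoint action restricted to the coinvariants. -/
noncomputable def coinvAct : M.coinvObj ⊗ H ⟶ M.coinvObj :=
  equalizer.lift (M.coinvι ▷ H ≫ M.adAction) (by
    rw [Category.assoc, ad_proj, ← comp_whiskerRight_assoc, coinvι_proj, Category.comp_id])

theorem coinvAct_ι : M.coinvAct ≫ M.coinvι = M.coinvι ▷ H ≫ M.adAction :=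
  equalizer.lift_ι _ _

/-- The coinvariants as a right module, with the adjoint action. -/
noncomputable def coinv : RightMod H where
  X := M.coinvObj
  act := M.coinvAct
  isRight :=
    { one := by
        rw [← cancel_mono M.coinvι, Category.assoc, coinvAct_ι, whisker_exchange_assoc,
          M.isRight_adAction.one, rightUnitor_naturality]
      mul := by
        rw [← cancel_mono M.coinvι, Category.assoc, coinvAct_ι, whisker_exchange_assoc,
          M.isRight_adAction.mul]
        simp only [Category.assoc]
        rw [coinvAct_ι, ← comp_whiskerRight_assoc, coinvAct_ι]
        simp }

end HopfBimod

section dualRegular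
variable [HasRightDual H]

theorem coact_ext {M X Z : C} [HasRightDual M] {f g : X ⟶ Z ⊗ Mᘁ}
    (h : f ▷ M ≫ (α_ _ _ _).hom ≫ Z ◁ ε_ M Mᘁ = g ▷ M ≫ (α_ _ _ _).hom ≫ Z ◁ ε_ M Mᘁ) : f = g := by
  apply (tensorRightHomEquiv X M Mᘁ Z).symm.injective
  simp only [tensorRightHomEquiv, Equiv.coe_fn_symm_mk]
  rw [reassoc_of% h]

variable (H) in
/-- Symbolically `f ⊗ x ↦ f(x₁) x₂`. -/
noncomputable def dualCoactMate : (Hᘁ : C) ⊗ H ⟶ H :=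
  (Hᘁ : C) ◁ Δ[H] ≫ (α_ _ _ _).inv ≫ ε_ H Hᘁ ▷ H ≫ (λ_ H).hom

variable (H) in
/-- The left coaction `f ↦ f₋₁ ⊗ f₀` on `H^*` dual to the right coaction `Δ` on `H`: symbolically
`f₋₁ f₀(x) = f(x₁) x₂`. -/
noncomputable def dualCoact : (Hᘁ : C) ⟶ H ⊗ Hᘁ :=
  (ρ_ (Hᘁ : C)).inv ≫ (Hᘁ : C) ◁ η_ H Hᘁ ≫ (α_ _ _ _).inv ≫ dualCoactMate H ▷ (Hᘁ : C)

theorem dualCoact_ev : dualCoact H ▷ H ≫ (α_ _ _ _).hom ≫ H ◁ ε_ H Hᘁ =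
    dualCoactMate H ≫ (ρ_ H).inv := by
  have := (tensorRightHomEquiv (Hᘁ : C) H Hᘁ H).symm_apply_apply (dualCoactMate H)
  rw [Iso.eq_comp_inv]
  simp only [Category.assoc]
  exact this

theorem dualCoact_counit : dualCoact H ≫ ε[H] ▷ (Hᘁ : C) = (λ_ (Hᘁ : C)).inv := by
  apply coact_ext
  calc _ = dualCoact H ▷ H ≫ (α_ _ _ _).hom ≫ (ε[H] ▷ ((Hᘁ : C) ⊗ H) ≫ 𝟙_ C ◁ ε_ H Hᘁ) := by
        monoidal
    _ = (dualCoact H ▷ H ≫ (α_ _ _ _).hom ≫ H ◁ ε_ H Hᘁ) ≫ ε[H] ▷ 𝟙_ C := by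
        rw [← whisker_exchange]
        simp only [Category.assoc]
    _ = (Hᘁ : C) ◁ Δ[H] ≫ (α_ _ _ _).inv ≫ (ε_ H Hᘁ ▷ H ≫ 𝟙_ C ◁ ε[H]) ⊗≫ 𝟙 _ := by
        rw [dualCoact_ev, dualCoactMate]
        monoidal
    _ = (Hᘁ : C) ◁ (Δ[H] ≫ H ◁ ε[H]) ⊗≫ ε_ H Hᘁ ⊗≫ 𝟙 _ := by
        rw [← whisker_exchange]
        monoidal
    _ = _ := by
        rw [ComonObj.comul_counit]
        monoidal

theorem dualCoact_coassoc : dualCoact H ≫ H ◁ dualCoact H =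
    dualCoact H ≫ Δ[H] ▷ (Hᘁ : C) ≫ (α_ _ _ _).hom := by
  rw [← cancel_mono (α_ _ _ _).inv]
  apply coact_ext
  calc _ = dualCoact H ▷ H ≫ (α_ _ _ _).hom ≫
          H ◁ (dualCoact H ▷ H ≫ (α_ _ _ _).hom ≫ H ◁ ε_ H Hᘁ) ≫ (α_ _ _ _).inv := by monoidal
    _ = (dualCoact H ▷ H ≫ (H ⊗ (Hᘁ : C)) ◁ Δ[H]) ⊗≫ H ◁ ε_ H Hᘁ ▷ H ⊗≫ 𝟙 _ := by
        rw [dualCoact_ev, dualCoactMate]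
        monoidal
    _ = (Hᘁ : C) ◁ Δ[H] ⊗≫ (dualCoact H ▷ H ≫ (α_ _ _ _).hom ≫ H ◁ ε_ H Hᘁ) ▷ H ⊗≫ 𝟙 _ := by
        rw [← whisker_exchange]
        monoidal
    _ = (Hᘁ : C) ◁ (Δ[H] ≫ Δ[H] ▷ H ≫ (α_ _ _ _).hom) ⊗≫ ε_ H Hᘁ ▷ (H ⊗ H) ⊗≫ 𝟙 _ := by
        rw [dualCoact_ev, dualCoactMate]
        monoidal
    _ = (Hᘁ : C) ◁ Δ[H] ⊗≫ ((Hᘁ ⊗ H : C) ◁ Δ[H] ≫ ε_ H Hᘁ ▷ (H ⊗ H)) ⊗≫ 𝟙 _ := by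
        rw [← ComonObj.comul_assoc]
        monoidal
    _ = dualCoactMate H ⊗≫ Δ[H] ⊗≫ 𝟙 _ := by
        rw [whisker_exchange, dualCoactMate]
        monoidal
    _ = (dualCoact H ▷ H ≫ (α_ _ _ _).hom ≫ H ◁ ε_ H Hᘁ) ≫ Δ[H] ▷ 𝟙_ C := by
        rw [dualCoact_ev]
        monoidal
    _ = dualCoact H ▷ H ≫ (α_ _ _ _).hom ≫ (H ◁ ε_ H Hᘁ ≫ Δ[H] ▷ 𝟙_ C) := by
        simp only [Category.assoc]
    _ = _ := by
        rw [whisker_exchange]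
        monoidal

theorem comul_left : μ[H] ≫ Δ[H] = H ◁ Δ[H] ≫ tensorActLeft μ[H] μ[H] := by
  rw [BimonObj.mul_comul, tensorActLeft, MonoidalCategory.tensorHom_def', Category.assoc]

theorem comul_right : μ[H] ≫ Δ[H] = Δ[H] ▷ H ≫ tensorActRight μ[H] μ[H] := by
  rw [BimonObj.mul_comul, tensorActRight, MonoidalCategory.tensorHom_def, Category.assoc]

theorem isLeft_mul : IsLeftAction μ[H] := ⟨MonObj.one_mul H, MonObj.mul_assoc H⟩
theorem isRight_mul : IsRightAction μ[H] := ⟨MonObj.mul_one H, by simp⟩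

theorem linL_comp {X Y Z : C} {a : H ⊗ X ⟶ X} {b : H ⊗ Y ⟶ Y} {c : H ⊗ Z ⟶ Z} {f : X ⟶ Y} {g : Y ⟶ Z}
    (hf : a ≫ f = H ◁ f ≫ b) (hg : b ≫ g = H ◁ g ≫ c) : a ≫ f ≫ g = H ◁ (f ≫ g) ≫ c := by
  rw [reassoc_of% hf, hg, whiskerLeft_comp_assoc]

theorem linL_inv {X Y : C} {a : H ⊗ X ⟶ X} {b : H ⊗ Y ⟶ Y} {e : X ≅ Y}
    (h : a ≫ e.hom = H ◁ e.hom ≫ b) : b ≫ e.inv = H ◁ e.inv ≫ a := by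
  rw [Iso.comp_inv_eq, Category.assoc, h, ← whiskerLeft_comp_assoc]
  simp

theorem linL_left {X Y Z : C} {a : H ⊗ X ⟶ X} {b : H ⊗ Y ⟶ Y} (z : H ⊗ Z ⟶ Z) {f : X ⟶ Y}
    (h : a ≫ f = H ◁ f ≫ b) : tensorActLeft z a ≫ Z ◁ f = H ◁ (Z ◁ f) ≫ tensorActLeft z b := by
  have := tensorActLeft_natural (a := z) (a' := z) (f := 𝟙 Z) (by simp) h
  simpa only [id_tensorHom] using this

theorem linL_right {X Y Z : C} {a : H ⊗ X ⟶ X} {b : H ⊗ Y ⟶ Y} (z : H ⊗ Z ⟶ Z) {f : X ⟶ Y}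
    (h : a ≫ f = H ◁ f ≫ b) : tensorActLeft a z ≫ f ▷ Z = H ◁ (f ▷ Z) ≫ tensorActLeft b z := by
  have := tensorActLeft_natural (b := z) (b' := z) (g := 𝟙 Z) h (by simp)
  simpa only [tensorHom_id] using this

theorem linR_comp {X Y Z : C} {a : X ⊗ H ⟶ X} {b : Y ⊗ H ⟶ Y} {c : Z ⊗ H ⟶ Z} {f : X ⟶ Y} {g : Y ⟶ Z}
    (hf : a ≫ f = f ▷ H ≫ b) (hg : b ≫ g = g ▷ H ≫ c) : a ≫ f ≫ g = (f ≫ g) ▷ H ≫ c := by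
  rw [reassoc_of% hf, hg, comp_whiskerRight_assoc]

theorem linR_inv {X Y : C} {a : X ⊗ H ⟶ X} {b : Y ⊗ H ⟶ Y} {e : X ≅ Y}
    (h : a ≫ e.hom = e.hom ▷ H ≫ b) : b ≫ e.inv = e.inv ▷ H ≫ a := by
  rw [Iso.comp_inv_eq, Category.assoc, h, ← comp_whiskerRight_assoc]
  simp

theorem linR_left {X Y Z : C} {a : X ⊗ H ⟶ X} {b : Y ⊗ H ⟶ Y} (z : Z ⊗ H ⟶ Z) {f : X ⟶ Y}
    (h : a ≫ f = f ▷ H ≫ b) : tensorActRight z a ≫ Z ◁ f = (Z ◁ f) ▷ H ≫ tensorActRight z b := by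
  have := tensorActRight_natural (a := z) (a' := z) (f := 𝟙 Z) (by simp) h
  simpa only [id_tensorHom] using this

theorem linR_right {X Y Z : C} {a : X ⊗ H ⟶ X} {b : Y ⊗ H ⟶ Y} (z : Z ⊗ H ⟶ Z) {f : X ⟶ Y}
    (h : a ≫ f = f ▷ H ≫ b) : tensorActRight a z ≫ f ▷ Z = f ▷ Z ▷ H ≫ tensorActRight b z := by
  have := tensorActRight_natural (b := z) (b' := z) (g := 𝟙 Z) h (by simp)
  simpa only [tensorHom_id] using this

theorem dualCoact_left : dualActLeft μ[H] ≫ dualCoact H =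
    H ◁ dualCoact H ≫ tensorActLeft μ[H] (dualActLeft μ[H]) := by
  have h : tensorActLeft (dualActLeft μ[H]) μ[H] ≫ dualCoactMate H =
      H ◁ dualCoactMate H ≫ μ[H] :=
    linL_comp (linL_left _ comul_left) <| linL_comp (linL_inv (tensorActLeft_assoc _ _ _)) <|
      linL_comp (linL_right _ (ev_left isLeft_mul)) (tensorActLeft_unit' _)
  exact linL_comp (linL_inv (tensorActLeft_unit _)) <| linL_comp (linL_left _ (coev_left isLeft_mul)) <|
    linL_comp (linL_inv (tensorActLeft_assoc _ _ _)) (linL_right _ h)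

theorem dualCoact_right [IsIso 𝒮[H]] : dualActRight μ[H] ≫ dualCoact H =
    dualCoact H ▷ H ≫ tensorActRight μ[H] (dualActRight μ[H]) := by
  have h : tensorActRight (dualActRight μ[H]) μ[H] ≫ dualCoactMate H =
      dualCoactMate H ▷ H ≫ μ[H] :=
    linR_comp (linR_left _ comul_right) <| linR_comp (linR_inv (tensorActRight_assoc _ _ _)) <|
      linR_comp (linR_right _ (ev_right isRight_mul)) (tensorActRight_unit' _)
  exact linR_comp (linR_inv (tensorActRight_unit _)) <|
    linR_comp (linR_left _ (coev_right isRight_mul)) <|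
    linR_comp (linR_inv (tensorActRight_assoc _ _ _)) (linR_right _ h)

variable (H) in
/-- The dual of the regular bimodule `H`. -/
noncomputable abbrev dualRegularBimod [IsIso 𝒮[H]] :
    Bimod (Mon.mk H) (Mon.mk H) :=
  @dualBimod C _ _ _ H _ (Bimod.regular (Mon.mk H)) ‹HasRightDual H› _

variable (H) in
/-- The Hopf bimodule `H^∨`. -/
noncomputable def dualRegular [IsIso 𝒮[H]] : HopfBimod H :=
  { dualRegularBimod H with
    coact := dualCoact H
    coact_counit := dualCoact_counit
    coact_coassoc := dualCoact_coassoc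
    actLeft_coact := dualCoact_left (H := H)
    actRight_coact := dualCoact_right (H := H) }

end dualRegular

section integrals
variable (H)

/-- Right integrals in `H` based on `X`: morphisms `t : X ⟶ H` with `m ∘ (t ⊗ H) = t ⊗ ε`. -/
def IsRightIntegral {X : C} (t : X ⟶ H) : Prop :=
  t ▷ H ≫ μ[H] = X ◁ ε[H] ≫ (ρ_ X).hom ≫ t

/-- The category of right integrals, a full subcategory of the category of objects over `H`. -/
abbrev RightIntegrals : Type _ :=
  ObjectProperty.FullSubcategory (fun t : Over H => IsRightIntegral H t.hom)

instance [HasRightDual H] [HasEqualizers C] : HasTerminal (RightIntegrals H) := by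
  let p : H ⟶ H ⊗ Hᘁ := tensorRightHomEquiv H H Hᘁ H μ[H]
  let q : H ⟶ H ⊗ Hᘁ := tensorRightHomEquiv H H Hᘁ H (H ◁ ε[H] ≫ (ρ_ H).hom)
  have key : ∀ {X : C} (t : X ⟶ H), IsRightIntegral H t ↔ t ≫ p = t ≫ q := by
    intro X t
    rw [← (tensorRightHomEquiv X H Hᘁ H).symm.injective.eq_iff,
      tensorRightHomEquiv_symm_naturality, tensorRightHomEquiv_symm_naturality,
      Equiv.symm_apply_apply, Equiv.symm_apply_apply, IsRightIntegral, ← whisker_exchange_assoc,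
      rightUnitor_naturality]
  let T : RightIntegrals H := ⟨Over.mk (equalizer.ι p q), (key _).2 (equalizer.condition p q)⟩
  refine IsTerminal.hasTerminal (X := T) (IsTerminal.ofUniqueHom
    (fun t => ObjectProperty.homMk (Over.homMk (equalizer.lift t.obj.hom ((key _).1 t.property))
      (equalizer.lift_ι _ _))) ?_)
  intro t m
  ext
  apply equalizer.hom_ext
  have := Over.w m.hom
  exact this.trans (equalizer.lift_ι _ _).symm

variable [HasRightDual H] [HasEqualizers C]

/-- The object of integrals: the source of the terminal right integral. -/
noncomputable def IntObj : C := (⊤_ (RightIntegrals H)).obj.left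

/-- The terminal right integral `Λ : Int(H) ⟶ H`. -/
noncomputable def intι : IntObj H ⟶ H := (⊤_ (RightIntegrals H)).obj.hom

/-- `χ` is a morphism of algebras with `m ∘ (id ⊗ Λ) = χ ⊗ Λ`. -/
structure IsModularFunction (χ : H ⟶ 𝟙_ C) : Prop extends IsMonHom χ where
  act_int : H ◁ intι H ≫ μ[H] = χ ▷ IntObj H ≫ (λ_ (IntObj H)).hom ≫ intι H
end integrals
end BraidedHopf

/-! Everything comes from the fundamental theorem of Hopf modules applied to `H^∨`. Its left action
`(h f)(x) = f(S(h) x)` and its left coaction need `S` but not `S⁻¹`, so the theorem is available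
before the antipode is known to be invertible. It gives `θ : H ⊗ I ≅ H^*`, where `I` splits the
idempotent `π`, and `θ` factors as `S ⊗ I`, a braiding, and `dualGen : f ⊗ h ↦ f(h -)`.

Antipode: by the factorization `S ⊗ I` is a split monomorphism. The unit object is a retract of
`H^*` (the counit, then evaluation at `1`), hence of `I ⊗ H`, so `I` can be cancelled and `S` is a
split monomorphism. The same argument in the opposite category makes `S` an epimorphism.

Integrals: now `dualGen : I ⊗ H ≅ H^*` is an isomorphism, right linear for `f · h = f(h -)`. Right
integrals with values in `I ⊗ H` factor through `I ⊗ Int(H)`, while the invariants of `H^*` are the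
multiples `f(1) ε` of the counit. Comparing the two shows that the pairing `I ⊗ Int(H) ⟶ 𝟙_ C`, `f ⊗
Λ ↦ f(Λ)`, is invertible (`isIso_pairing`). So `Int(H)` is an invertible object and `I ≅ Int(H)^*`.

Modular function: left multiplication preserves right integrals, so `H` acts on `Int(H)`; on an
invertible object an action is a unique algebra morphism `χ : H ⟶ 𝟙_ C`. Under the pairing, the
right factor of the adjoint action acts by `ε`, because `Λ` is a right integral, and the left factor
gives `f(S²(h) Λ) = χ(S²(h)) f(Λ)`. Finally `χ ∘ S² = χ`, since `χ ∘ S` is a convolution inverse of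
`χ`. -/

namespace BraidedHopf
-- Hopf modules and their coinvariants
section fundamental
variable {C : Type u} [Category.{v} C] [MonoidalCategory C] [BraidedCategory C] {H : C} [HopfObj H]
variable {M : C} {a : H ⊗ M ⟶ M} {δ : M ⟶ H ⊗ M}

/-- Symbolically `m₋₁ · π(m₀) = m`. -/
theorem coact_pi_act (ha : IsLeftAction a) (hδ : δ ≫ ε[H] ▷ M = (λ_ M).inv)
    (hδ' : δ ≫ H ◁ δ = δ ≫ Δ[H] ▷ M ≫ (α_ H H M).hom) :
    δ ≫ H ◁ (δ ≫ 𝒮[H] ▷ M ≫ a) ≫ a = 𝟙 M := by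
  calc _ = (δ ≫ H ◁ δ) ≫ H ◁ 𝒮[H] ▷ M ≫ H ◁ a ≫ a := by simp
    _ = δ ≫ (Δ[H] ≫ H ◁ 𝒮[H]) ▷ M ≫ (α_ _ _ _).hom ≫ H ◁ a ≫ a := by rw [hδ']; simp
    _ = δ ≫ (Δ[H] ≫ H ◁ 𝒮[H] ≫ μ[H]) ▷ M ≫ a := by rw [← ha.mul]; monoidal
    _ = (δ ≫ ε[H] ▷ M) ≫ η[H] ▷ M ≫ a := by rw [HopfObj.antipode_right]; simp
    _ = 𝟙 M := by rw [hδ, ha.one]; simp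

/-- Symbolically `(h · m)₋₁ ⊗ π((h · m)₀) = h m₋₁ ⊗ π(m₀)`. -/
theorem act_coact_pi (ha : IsLeftAction a) (h : a ≫ δ = H ◁ δ ≫ tensorActLeft μ[H] a) :
    a ≫ δ ≫ H ◁ (δ ≫ 𝒮[H] ▷ M ≫ a) =
      H ◁ (δ ≫ H ◁ (δ ≫ 𝒮[H] ▷ M ≫ a)) ≫ (α_ _ _ _).inv ≫ μ[H] ▷ M := by
  -- Here `π(h · m) = ε(h) π(m)`, so the second leg of `Δ(h)` is absorbed by the counit.
  have hπ := pi_left ha h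
  generalize hp : δ ≫ 𝒮[H] ▷ M ≫ a = p at hπ ⊢
  have e := tensorμ_natural_left (𝟙 H) ε[H] H M
  simp only [id_tensorHom, id_whiskerRight] at e
  calc _ = H ◁ δ ≫ Δ[H] ▷ (H ⊗ M) ≫ tensorμ H H H M ≫ (H ⊗ H) ◁ (a ≫ p) ≫ μ[H] ▷ M := by
        rw [reassoc_of% h]
        simp only [tensorActLeft, MonoidalCategory.tensorHom_def', Category.assoc, whiskerLeft_comp]
        rw [whisker_exchange]
    _ = H ◁ δ ≫ Δ[H] ▷ (H ⊗ M) ≫ (tensorμ H H H M ≫ (H ⊗ H) ◁ ε[H] ▷ M) ≫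
          (H ⊗ H) ◁ ((λ_ M).hom ≫ p) ≫ μ[H] ▷ M := by
        rw [hπ]; simp only [whiskerLeft_comp, Category.assoc]
    _ = H ◁ δ ≫ (Δ[H] ≫ H ◁ ε[H]) ▷ (H ⊗ M) ≫ tensorμ H (𝟙_ C) H M ≫
          (H ⊗ H) ◁ ((λ_ M).hom ≫ p) ≫ μ[H] ▷ M := by
        rw [← e]; simp only [comp_whiskerRight, Category.assoc]
    _ = _ := by
        rw [ComonObj.comul_counit]
        simp only [tensorμ, braiding_tensorUnit_left]
        monoidal

/-- Symbolically `π(m)₋₁ ⊗ π(π(m)₀) = 1 ⊗ π(m)`. -/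
theorem pi_coact_pi (ha : IsLeftAction a) (hδ : δ ≫ ε[H] ▷ M = (λ_ M).inv)
    (hδ' : δ ≫ H ◁ δ = δ ≫ Δ[H] ▷ M ≫ (α_ H H M).hom)
    (h : a ≫ δ = H ◁ δ ≫ tensorActLeft μ[H] a) :
    (δ ≫ 𝒮[H] ▷ M ≫ a) ≫ δ ≫ H ◁ (δ ≫ 𝒮[H] ▷ M ≫ a) =
      (δ ≫ 𝒮[H] ▷ M ≫ a) ≫ (λ_ M).inv ≫ η[H] ▷ M := by
  have h1 := act_coact_pi ha h
  generalize hp : δ ≫ 𝒮[H] ▷ M ≫ a = p at h1 ⊢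
  calc _ = δ ≫ 𝒮[H] ▷ M ≫ (a ≫ δ ≫ H ◁ p) := by rw [← hp]; simp only [Category.assoc]
    _ = (δ ≫ H ◁ δ) ≫ (𝒮[H] ▷ (H ⊗ M) ≫ H ◁ (H ◁ p)) ≫ (α_ _ _ _).inv ≫ μ[H] ▷ M := by
        rw [h1, ← whisker_exchange_assoc, whiskerLeft_comp]
        simp only [Category.assoc]
        rw [whisker_exchange_assoc]
    -- Coassociativity puts `S` and the identity on the two legs of one coproduct, where the
    -- antipode axiom applies.
    _ = δ ≫ (Δ[H] ≫ 𝒮[H] ▷ H ≫ μ[H]) ▷ M ≫ H ◁ p := by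
        rw [hδ', ← whisker_exchange]
        calc _ = δ ≫ Δ[H] ▷ M ⊗≫ ((H ⊗ H) ◁ p ≫ (𝒮[H] ▷ H ≫ μ[H]) ▷ M) := by monoidal
          _ = _ := by rw [whisker_exchange]; monoidal
    _ = (δ ≫ ε[H] ▷ M) ≫ η[H] ▷ M ≫ H ◁ p := by rw [HopfObj.antipode_left]; simp
    _ = _ := by rw [hδ, ← whisker_exchange]; simp

/-- The counit on the `H` leg of `pi_coact_pi` turns its two sides into `π ∘ π` and `π`. -/
theorem pi_idem (ha : IsLeftAction a) (hδ : δ ≫ ε[H] ▷ M = (λ_ M).inv)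
    (hδ' : δ ≫ H ◁ δ = δ ≫ Δ[H] ▷ M ≫ (α_ H H M).hom)
    (h : a ≫ δ = H ◁ δ ≫ tensorActLeft μ[H] a) :
    (δ ≫ 𝒮[H] ▷ M ≫ a) ≫ (δ ≫ 𝒮[H] ▷ M ≫ a) = δ ≫ 𝒮[H] ▷ M ≫ a := by
  have h1 := pi_coact_pi ha hδ hδ' h
  generalize δ ≫ 𝒮[H] ▷ M ≫ a = p at h1 ⊢
  have h2 := h1 =≫ (ε[H] ▷ M ≫ (λ_ M).hom)
  simp only [Category.assoc] at h2
  rw [whisker_exchange_assoc, reassoc_of% hδ, leftUnitor_naturality, Iso.inv_hom_id_assoc,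
    ← comp_whiskerRight_assoc, BimonObj.one_counit] at h2
  simpa using h2

/-- The fundamental theorem of Hopf modules: a Hopf module is free over a splitting of the
projection to its coinvariants. -/
def fundamentalIso (ha : IsLeftAction a) (hδ : δ ≫ ε[H] ▷ M = (λ_ M).inv)
    (hδ' : δ ≫ H ◁ δ = δ ≫ Δ[H] ▷ M ≫ (α_ H H M).hom)
    (h : a ≫ δ = H ◁ δ ≫ tensorActLeft μ[H] a) {I : C} {i : I ⟶ M} {q : M ⟶ I} (hi : i ≫ q = 𝟙 I)
    (hq : q ≫ i = δ ≫ 𝒮[H] ▷ M ≫ a) : H ⊗ I ≅ M where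
  hom := H ◁ i ≫ a
  inv := δ ≫ H ◁ q
  hom_inv_id := by
    have h1 := act_coact_pi ha h
    have h2 := pi_coact_pi ha hδ hδ' h
    rw [← hq] at h1 h2
    -- Coinvariance of `i`, in the weak form with `π` applied to the second leg; this suffices
    -- because the inverse map projects that leg anyway.
    have h3 : i ≫ δ ≫ H ◁ (q ≫ i) = i ≫ (λ_ M).inv ≫ η[H] ▷ M := by
      have := i ≫= h2
      simpa only [Category.assoc, reassoc_of% hi] using this
    have hm : Function.Injective fun f : H ⊗ I ⟶ H ⊗ I => f ≫ H ◁ i := fun f g hfg => by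
      have := hfg =≫ H ◁ q
      simpa [← whiskerLeft_comp, hi] using this
    apply hm
    calc _ = H ◁ i ≫ a ≫ δ ≫ H ◁ (q ≫ i) := by simp
      _ = H ◁ (i ≫ δ ≫ H ◁ (q ≫ i)) ≫ (α_ _ _ _).inv ≫ μ[H] ▷ M := by
        rw [h1, ← whiskerLeft_comp_assoc]
      _ = _ := by
        rw [h3]
        calc _ = H ◁ i ⊗≫ (H ◁ η[H] ≫ μ[H]) ▷ M := by monoidal
          _ = _ := by rw [MonObj.mul_one]; monoidal
  inv_hom_id := by
    rw [Category.assoc, ← whiskerLeft_comp_assoc, hq, coact_pi_act ha hδ hδ']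

end fundamental

/-! ### The antipode is a split monomorphism -/

section antipode
variable {C : Type u} [Category.{v} C] [MonoidalCategory C] [BraidedCategory C]

/-- If `f ▷ I` is a split monomorphism and `𝟙_ C` is a retract of `I ⊗ J`, then `f` is a split
monomorphism. -/
theorem isSplitMono_of_whiskerRight {A B I J : C} (f : A ⟶ B) [IsSplitMono (f ▷ I)]
    {c : 𝟙_ C ⟶ I ⊗ J} {p : I ⊗ J ⟶ 𝟙_ C} (h : c ≫ p = 𝟙 _) : IsSplitMono f := by
  -- The retraction creates `I ⊗ J` by `c`, retracts `f ▷ I`, and removes `I ⊗ J` by `p`.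
  refine IsSplitMono.mk' ⟨(ρ_ B).inv ≫ B ◁ c ≫ (α_ _ _ _).inv ≫ retraction (f ▷ I) ▷ J ≫
    (α_ _ _ _).hom ≫ A ◁ p ≫ (ρ_ A).hom, ?_⟩
  calc _ = 𝟙 _ ⊗≫ (f ▷ 𝟙_ C ≫ B ◁ c) ⊗≫ retraction (f ▷ I) ▷ J ⊗≫ A ◁ p ⊗≫ 𝟙 _ := by monoidal
    _ = 𝟙 _ ⊗≫ A ◁ c ⊗≫ (f ▷ I ≫ retraction (f ▷ I)) ▷ J ⊗≫ A ◁ p ⊗≫ 𝟙 _ := by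
      rw [← whisker_exchange]; monoidal
    _ = 𝟙 _ ⊗≫ A ◁ (c ≫ p) ⊗≫ 𝟙 _ := by rw [IsSplitMono.id]; monoidal
    _ = _ := by rw [h]; monoidal

variable {H : C} [HopfObj H] [HasRightDual H]

variable (H) in
/-- The counit as an element of the dual. -/
noncomputable def counitDual : 𝟙_ C ⟶ Hᘁ := toDual ((λ_ H).hom ≫ ε[H])

variable (H) in
/-- Evaluation of functionals at the unit. -/
noncomputable def evOne : (Hᘁ : C) ⟶ 𝟙_ C := (ρ_ _).inv ≫ (Hᘁ : C) ◁ η[H] ≫ ε_ H Hᘁ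

/-- This is `ε(1) = 1`. It makes the unit object a retract of `H^*`. -/
theorem counitDual_evOne : counitDual H ≫ evOne H = 𝟙 (𝟙_ C) := by
  calc _ = (ρ_ _).inv ≫ (counitDual H ▷ 𝟙_ C ≫ (Hᘁ : C) ◁ η[H]) ≫ ε_ H Hᘁ := by
        rw [evOne]; simp only [Category.assoc, rightUnitor_inv_naturality_assoc]
    _ = (ρ_ _).inv ≫ 𝟙_ C ◁ η[H] ≫ (counitDual H ▷ H ≫ ε_ H Hᘁ) := by
        rw [← whisker_exchange]; simp only [Category.assoc]
    _ = _ := by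
        rw [counitDual, toDual_ev, leftUnitor_naturality_assoc, BimonObj.one_counit]
        simp [unitors_equal]

/-- Symbolically `f ⊗ h ↦ f(h -)`, for functionals `f` in the image of `i`. -/
noncomputable def dualGen {I : C} (i : I ⟶ Hᘁ) : I ⊗ H ⟶ Hᘁ := i ▷ H ≫ dualOp μ[H]

/-- The antipode in `(h f)(x) = f(S(h) x)` splits off. This turns an isomorphism built from the
action into information about `S`. -/
theorem act_eq_dualGen {I : C} (i : I ⟶ Hᘁ) :
    H ◁ i ≫ dualActLeft μ[H] = 𝒮[H] ▷ I ≫ (β_ H I).hom ≫ dualGen i := by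
  rw [dualActLeft, dualGen, BraidedCategory.braiding_naturality_right_assoc,
    BraidedCategory.braiding_naturality_left_assoc, whisker_exchange_assoc]

variable (H) in
/-- The dual of the regular module is free over a splitting of the projection to its
coinvariants. -/
noncomputable def dualFundamentalIso {I : C} {i : I ⟶ Hᘁ} {q : (Hᘁ : C) ⟶ I} (hi : i ≫ q = 𝟙 I)
    (hq : q ≫ i = dualCoact H ≫ 𝒮[H] ▷ (Hᘁ : C) ≫ dualActLeft μ[H]) : H ⊗ I ≅ Hᘁ :=
  fundamentalIso (isLeft_mul (H := H)).dual.toLeft dualCoact_counit dualCoact_coassoc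
    dualCoact_left hi hq

/-- The isomorphism `θ` starts with `S ▷ I`, and the unit object is a retract of `H^* ≅ I ⊗ H`, so
`I` can be cancelled. Only split idempotents are assumed: unlike equalizers, they are a self-dual
requirement, so the result also applies in `Cᵒᵖ`. -/
theorem isSplitMono_antipode [IsIdempotentComplete C] : IsSplitMono 𝒮[H] := by
  obtain ⟨I, i, q, hi, hq⟩ := IsIdempotentComplete.idempotents_split _ _
    (pi_idem (isLeft_mul (H := H)).dual.toLeft dualCoact_counit dualCoact_coassoc dualCoact_left)
  let θ := dualFundamentalIso H hi hq
  have hθ : θ.hom = 𝒮[H] ▷ I ≫ (β_ H I).hom ≫ dualGen i := act_eq_dualGen i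
  have : IsSplitMono (𝒮[H] ▷ I) :=
    IsSplitMono.mk' ⟨((β_ H I).hom ≫ dualGen i) ≫ θ.inv, by
      rw [← Category.assoc, ← hθ, Iso.hom_inv_id]⟩
  refine isSplitMono_of_whiskerRight (I := I) (J := H) 𝒮[H]
    (c := counitDual H ≫ θ.inv ≫ (β_ H I).hom) (p := (β_ H I).inv ≫ θ.hom ≫ evOne H) ?_
  simp [counitDual_evOne]

end antipode

/-! ### Invertibility of the antipode, by passing to the opposite category -/

section opposite
variable {C : Type u} [Category.{v} C] [MonoidalCategory C] [BraidedCategory C]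
open Opposite

/-- A Hopf algebra is a Hopf algebra in the opposite category, with multiplication and
comultiplication exchanged. -/
@[reducible] def hopfObjOp (H : C) [HopfObj H] : HopfObj (op H) where
  one := ε[H].op
  mul := Δ[H].op
  counit := η[H].op
  comul := μ[H].op
  one_mul := Quiver.Hom.unop_inj (ComonObj.counit_comul H)
  mul_one := Quiver.Hom.unop_inj (ComonObj.comul_counit H)
  mul_assoc := Quiver.Hom.unop_inj (by
    simp)
  counit_comul := Quiver.Hom.unop_inj (MonObj.one_mul H)
  comul_counit := Quiver.Hom.unop_inj (MonObj.mul_one H)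
  comul_assoc := Quiver.Hom.unop_inj (by simp)
  mul_comul := Quiver.Hom.unop_inj (by
    refine (BimonObj.mul_comul H).trans ?_
    simp)
  one_comul := Quiver.Hom.unop_inj (by
    refine (Bimon.mul_counit H).trans ?_
    rfl)
  mul_counit := Quiver.Hom.unop_inj (by
    refine (Bimon.one_comul H).trans ?_
    rfl)
  one_counit := Quiver.Hom.unop_inj (BimonObj.one_counit H)
  antipode := 𝒮[H].op
  antipode_left := Quiver.Hom.unop_inj (by
    refine Eq.trans ?_ (HopfObj.antipode_left H)
    exact Category.assoc _ _ _)
  antipode_right := Quiver.Hom.unop_inj (by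
    refine Eq.trans ?_ (HopfObj.antipode_right H)
    exact Category.assoc _ _ _)

/-- A left dual is a right dual in the opposite category. -/
@[reducible] def hasRightDualOp (H : C) [HasLeftDual H] : HasRightDual (op H) where
  rightDual := op (ᘁH : C)
  exact :=
    { coevaluation' := (ε_ (ᘁH : C) H).op
      evaluation' := (η_ (ᘁH : C) H).op
      coevaluation_evaluation' := Quiver.Hom.unop_inj (by
        refine Eq.trans ?_ (ExactPairing.evaluation_coevaluation (ᘁH : C) H)
        exact Category.assoc _ _ _)
      evaluation_coevaluation' := Quiver.Hom.unop_inj (by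
        refine Eq.trans ?_ (ExactPairing.coevaluation_evaluation (ᘁH : C) H)
        exact Category.assoc _ _ _) }

/-- The antipode of `op H` is `𝒮[H].op`, so its being a monomorphism in `Cᵒᵖ` makes `𝒮[H]` an
epimorphism. The left dual of `H` supplies the right dual of `op H`. -/
theorem isIso_antipode [HasEqualizers C] (H : C) [HopfObj H] [HasRightDual H] [HasLeftDual H] :
    IsIso 𝒮[H] := by
  have : IsIdempotentComplete C :=
    (Idempotents.isIdempotentComplete_iff_hasEqualizer_of_id_and_idempotent C).2
      fun _ _ _ => inferInstance
  let _ := hopfObjOp H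
  let _ := hasRightDualOp H
  have : IsSplitMono 𝒮[H] := isSplitMono_antipode
  have hop : IsSplitMono 𝒮[op H] := isSplitMono_antipode
  have : Epi 𝒮[H] := by
    have : Mono 𝒮[op H] := inferInstance
    have e : 𝒮[H] = (𝒮[op H]).unop := rfl
    rw [e]
    infer_instance
  exact isIso_of_epi_of_isSplitMono _

end opposite

/-! ### Integrals and their pairing with functionals -/

section integrals
variable {C : Type u} [Category.{v} C] [MonoidalCategory C] [BraidedCategory C]
variable {H : C} [HopfObj H] [HasRightDual H] [HasEqualizers C]

variable (H) in
theorem isRightIntegral_intι : IsRightIntegral H (intι H) := (⊤_ (RightIntegrals H)).property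

/-- The factorization of an integral through the terminal one. -/
noncomputable def intLift {X : C} (t : X ⟶ H) (ht : IsRightIntegral H t) : X ⟶ IntObj H :=
  (terminal.from (⟨Over.mk t, ht⟩ : RightIntegrals H)).hom.left

theorem intLift_ι {X : C} (t : X ⟶ H) (ht : IsRightIntegral H t) : intLift t ht ≫ intι H = t :=
  Over.w (terminal.from (⟨Over.mk t, ht⟩ : RightIntegrals H)).hom

theorem IsRightIntegral.comp {X Y : C} {t : X ⟶ H} (ht : IsRightIntegral H t) (f : Y ⟶ X) :
    IsRightIntegral H (f ≫ t) := by
  rw [IsRightIntegral] at ht ⊢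
  rw [comp_whiskerRight_assoc, ht, ← whisker_exchange_assoc, rightUnitor_naturality_assoc]

/-- If `f` and `g` agree after `Λ`, the common composite is an integral, and both are morphisms from
it to the terminal integral. -/
instance mono_intι : Mono (intι H) where
  right_cancellation {X} f g h := by
    have ht := (isRightIntegral_intι H).comp f
    let T : RightIntegrals H := ⟨Over.mk (f ≫ intι H), ht⟩
    let F : T ⟶ ⊤_ (RightIntegrals H) := ObjectProperty.homMk (Over.homMk f rfl)
    let G : T ⟶ ⊤_ (RightIntegrals H) := ObjectProperty.homMk (Over.homMk g h.symm)
    have := terminal.hom_ext F G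
    exact congrArg (fun k => k.hom.left) this

/-- Tensoring with `I` is right adjoint to tensoring with its dual, so it preserves monomorphisms.
-/
theorem whiskerLeft_mono (I : C) [HasRightDual I] {X Y : C} (f : X ⟶ Y) [Mono f] : Mono (I ◁ f) := by
  have := (tensorLeftAdjunction I Iᘁ).isRightAdjoint
  exact inferInstanceAs (Mono ((tensorLeft I).map f))

/-- Integrals with values in `I ⊗ H` factor through `I ⊗ Int(H)`. -/
theorem exists_lift_whiskerLeft (I : C) [HasRightDual I] {X : C} (t : X ⟶ I ⊗ H)
    (ht : t ▷ H ≫ (α_ _ _ _).hom ≫ I ◁ μ[H] = X ◁ ε[H] ≫ (ρ_ X).hom ≫ t) :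
    ∃ k : X ⟶ I ⊗ IntObj H, k ≫ I ◁ intι H = t := by
  -- Transposing `I` to the source gives an integral in `H` itself, to which terminality applies.
  let t' : (Iᘁ : C) ⊗ X ⟶ H := (Iᘁ : C) ◁ t ≫ (α_ _ _ _).inv ≫ ε_ I Iᘁ ▷ H ≫ (λ_ H).hom
  have ht' : IsRightIntegral H t' := by
    rw [IsRightIntegral]
    calc _ = 𝟙 _ ⊗≫ (Iᘁ : C) ◁ (t ▷ H) ⊗≫ (ε_ I Iᘁ ▷ (H ⊗ H) ≫ 𝟙_ C ◁ μ[H]) ⊗≫ 𝟙 _ := by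
          monoidal
      _ = 𝟙 _ ⊗≫ (Iᘁ : C) ◁ (t ▷ H ≫ (α_ _ _ _).hom ≫ I ◁ μ[H]) ⊗≫ ε_ I Iᘁ ▷ H ⊗≫ 𝟙 _ := by
          rw [← whisker_exchange]; monoidal
      _ = _ := by rw [ht]; monoidal
  refine ⟨(λ_ X).inv ≫ η_ I Iᘁ ▷ X ≫ (α_ _ _ _).hom ≫ I ◁ intLift t' ht', ?_⟩
  calc _ = (λ_ X).inv ≫ η_ I Iᘁ ▷ X ≫ (α_ _ _ _).hom ≫ I ◁ t' := by
        simp only [Category.assoc, ← whiskerLeft_comp, intLift_ι]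
    _ = t := (tensorLeftHomEquiv X I Iᘁ H).apply_symm_apply t

variable (H) in
/-- Evaluation of functionals on integrals. -/
noncomputable def evInt : (Hᘁ : C) ⊗ IntObj H ⟶ 𝟙_ C := (Hᘁ : C) ◁ intι H ≫ ε_ H Hᘁ

theorem dualGen_ev {I : C} (i : I ⟶ Hᘁ) : dualGen i ▷ H ≫ ε_ H Hᘁ =
    (α_ _ _ _).hom ≫ I ◁ μ[H] ≫ i ▷ H ≫ ε_ H Hᘁ := by
  rw [dualGen, comp_whiskerRight_assoc, dualOp_ev, associator_naturality_left_assoc,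
    whisker_exchange_assoc]

/-- Right linearity: `f(h h' -)` is `f(h -)` acted on by `h'`. -/
theorem dualGen_mul {I : C} (i : I ⟶ Hᘁ) :
    (α_ _ _ _).hom ≫ I ◁ μ[H] ≫ dualGen i = dualGen i ▷ H ≫ dualOp μ[H] := by
  rw [dualGen, whisker_exchange_assoc, (isLeft_mul (H := H)).dual.mul]
  simp

/-- Because `Λ h = ε(h) Λ`, the functional `f(Λ -)` equals `f(Λ) ε`, so the pairing appears as the
coefficient of the counit. -/
theorem whiskerLeft_intι_dualGen {I : C} (i : I ⟶ Hᘁ) :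
    I ◁ intι H ≫ dualGen i = (i ▷ IntObj H ≫ evInt H) ≫ counitDual H := by
  apply dual_hom_ext
  rw [comp_whiskerRight_assoc, dualGen_ev, comp_whiskerRight_assoc, counitDual, toDual_ev]
  have hΛ := isRightIntegral_intι H
  rw [IsRightIntegral] at hΛ
  calc _ = (α_ _ _ _).hom ≫ I ◁ (intι H ▷ H ≫ μ[H]) ≫ i ▷ H ≫ ε_ H Hᘁ := by simp
    _ = (α_ _ _ _).hom ≫ I ◁ (IntObj H ◁ ε[H] ≫ (ρ_ _).hom) ≫ (I ◁ intι H ≫ i ▷ H) ≫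
          ε_ H Hᘁ := by rw [hΛ]; simp
    _ = ((I ⊗ IntObj H) ◁ ε[H] ≫ (i ▷ IntObj H ≫ evInt H) ▷ 𝟙_ C) ≫ (ρ_ _).hom := by
        rw [whisker_exchange, evInt]; monoidal
    _ = _ := by rw [whisker_exchange]; monoidal

/-- Multiplicativity of `ε` makes the counit an invariant functional; carried back along `dualGen`
it becomes an integral in `I ⊗ H`. -/
theorem counitDual_act : counitDual H ▷ H ≫ dualOp μ[H] = 𝟙_ C ◁ ε[H] ≫ (ρ_ _).hom ≫ counitDual H := by
  apply dual_hom_ext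
  rw [comp_whiskerRight_assoc, dualOp_ev, comp_whiskerRight_assoc, comp_whiskerRight_assoc,
    associator_naturality_left_assoc, ← whisker_exchange_assoc, counitDual, toDual_ev,
    leftUnitor_naturality_assoc, Bimon.mul_counit, MonoidalCategory.tensorHom_def]
  monoidal

/-- The pairing of functionals generating the dual with integrals is perfect. -/
theorem isIso_pairing {I : C} [HasRightDual I] (i : I ⟶ Hᘁ) [IsIso (dualGen i)] :
    IsIso (i ▷ IntObj H ≫ evInt H) := by
  -- The inverse of the pairing: the counit, pulled back along `dualGen`, factors through `I ⊗
  -- Int(H)`.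
  obtain ⟨k, hk⟩ := exists_lift_whiskerLeft I (counitDual H ≫ inv (dualGen i)) (by
    rw [← cancel_mono (dualGen i)]
    simp only [Category.assoc, dualGen_mul, IsIso.inv_hom_id, Category.comp_id]
    rw [← comp_whiskerRight_assoc, Category.assoc, IsIso.inv_hom_id, Category.comp_id,
      counitDual_act])
  have h := whiskerLeft_intι_dualGen i
  have := whiskerLeft_mono I (intι H)
  refine ⟨k, ?_, ?_⟩
  · rw [← cancel_mono (I ◁ intι H), ← cancel_mono (dualGen i)]
    simp only [Category.assoc, hk, IsIso.inv_hom_id, Category.comp_id, Category.id_comp] at h ⊢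
    exact h.symm
  -- The other composite is the identity once multiplied by the counit; evaluation at `1` removes
  -- that factor.
  · have e : (k ≫ i ▷ IntObj H ≫ evInt H) ≫ counitDual H = counitDual H := by
      rw [Category.assoc, ← h, reassoc_of% hk, IsIso.inv_hom_id, Category.comp_id]
    have := e =≫ evOne H
    rwa [Category.assoc, counitDual_evOne, Category.comp_id] at this
end integrals

/-! ### Invertible objects -/

section invertible
variable {C : Type u} [Category.{v} C] [MonoidalCategory C] [BraidedCategory C]

/-- Tensoring with an invertible object is an equivalence. -/
theorem isEquivalence_tensorRight {I K : C} (e : I ⊗ K ≅ 𝟙_ C) : (tensorRight K).IsEquivalence := by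
  -- The braiding makes the one-sided inverse two-sided.
  let e' : K ⊗ I ≅ 𝟙_ C := (β_ K I) ≪≫ e
  let E := CategoryTheory.Equivalence.mk (tensorRight K) (tensorRight I)
    (NatIso.ofComponents (fun X => (ρ_ X).symm ≪≫ whiskerLeftIso X e'.symm ≪≫ (α_ X K I).symm)
      (fun {X Y} f => by
        dsimp
        simp only [Category.assoc, rightUnitor_inv_naturality_assoc, whiskerLeftIso_hom,
          ← whisker_exchange_assoc, associator_inv_naturality_left]))
    (NatIso.ofComponents (fun X => (α_ X I K) ≪≫ whiskerLeftIso X e ≪≫ (ρ_ X))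
      (fun {X Y} f => by
        dsimp
        simp only [Category.assoc, ← rightUnitor_naturality, whiskerLeftIso_hom,
          whisker_exchange_assoc, associator_naturality_left_assoc]))
  exact E.isEquivalence_functor

/-- An invertible pairing makes `- ⊗ K` fully faithful; the preimage of `ev` followed by `P⁻¹` is
the inverse `K^* ⟶ I`. -/
theorem isIso_toDual {I K : C} [HasRightDual K] (P : I ⊗ K ⟶ 𝟙_ C) [IsIso P] : IsIso (toDual P) := by
  have := isEquivalence_tensorRight (asIso P)
  obtain ⟨g, hg⟩ := (tensorRight K).map_surjective (X := Kᘁ) (Y := I) (ε_ K Kᘁ ≫ inv P)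
  change g ▷ K = _ at hg
  refine ⟨g, ?_, ?_⟩
  · apply (tensorRight K).map_injective
    change (toDual P ≫ g) ▷ K = (𝟙 I) ▷ K
    rw [comp_whiskerRight, hg, ← Category.assoc, toDual_ev, IsIso.hom_inv_id, id_whiskerRight]
  · apply dual_hom_ext
    rw [comp_whiskerRight_assoc, toDual_ev, hg]
    simp
end invertible

/-! ### The modular function -/

section modular
variable {C : Type u} [Category.{v} C] [MonoidalCategory C] [BraidedCategory C]
variable {H : C} [HopfObj H] [HasRightDual H] [HasEqualizers C]

/-- By associativity `h Λ` is again a right integral, which gives a map `H ⊗ Int(H) ⟶ Int(H)`.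
Fullness of `- ⊗ Int(H)` writes it as `χ ⊗ id`; faithfulness gives uniqueness and turns the action
laws into multiplicativity of `χ`. -/
theorem existsUnique_modularFunction [(tensorRight (IntObj H)).IsEquivalence] :
    ∃! χ : H ⟶ 𝟙_ C, IsModularFunction H χ := by
  have inj : ∀ {X : C} {f g : X ⟶ 𝟙_ C},
      f ▷ IntObj H ≫ (λ_ _).hom ≫ intι H = g ▷ IntObj H ≫ (λ_ _).hom ≫ intι H → f = g := by
    intro X f g h
    apply (tensorRight (IntObj H)).map_injective
    change f ▷ IntObj H = g ▷ IntObj H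
    rwa [← cancel_mono ((λ_ (IntObj H)).hom ≫ intι H)]
  have ht : IsRightIntegral H (H ◁ intι H ≫ μ[H]) := by
    have hΛ := isRightIntegral_intι H
    rw [IsRightIntegral] at hΛ ⊢
    calc _ = (α_ _ _ _).hom ≫ H ◁ (intι H ▷ H ≫ μ[H]) ≫ μ[H] := by simp
      _ = _ := by rw [hΛ]; simp
  obtain ⟨χ, hχ⟩ := (tensorRight (IntObj H)).map_surjective (X := H) (Y := 𝟙_ C)
    (intLift _ ht ≫ (λ_ _).inv)
  change χ ▷ IntObj H = _ at hχ
  have act : H ◁ intι H ≫ μ[H] = χ ▷ IntObj H ≫ (λ_ (IntObj H)).hom ≫ intι H := by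
    rw [hχ, Category.assoc, Iso.inv_hom_id_assoc, intLift_ι]
  refine ⟨χ, { act_int := act, one_hom := ?_, mul_hom := ?_ }, fun ψ hψ => ?_⟩
  · apply inj
    rw [comp_whiskerRight_assoc, ← act, ← whisker_exchange_assoc, MonObj.one_mul]
    simp
  · apply inj
    rw [comp_whiskerRight_assoc, ← act, ← whisker_exchange_assoc, MonObj.mul_assoc]
    calc _ = (α_ _ _ _).hom ≫ H ◁ (H ◁ intι H ≫ μ[H]) ≫ μ[H] := by simp
      _ = (α_ _ _ _).hom ≫ H ◁ (χ ▷ IntObj H ≫ (λ_ (IntObj H)).hom) ≫ (H ◁ intι H ≫ μ[H]) := by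
        conv_lhs => rw [act]
        simp
      _ = _ := by
        rw [act, MonoidalCategory.tensorHom_def']
        simp
  · exact inj (by rw [← hψ.act_int, act])
end modular

/-! ### Characters and the adjoint action -/

section character
variable {C : Type u} [Category.{v} C] [MonoidalCategory C] [BraidedCategory C]
variable {H : C} [HopfObj H]

/-- The antipode is antimultiplicative, but the braiding of the unit object with itself is trivial,
so the order of the factors is lost. -/
theorem isMonHom_antipode_comp (χ : H ⟶ 𝟙_ C) [IsMonHom χ] : IsMonHom (𝒮[H] ≫ χ) where
  one_hom := by rw [HopfObj.one_antipode_assoc, IsMonHom.one_hom]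
  mul_hom := by
    calc _ = (𝒮[H] ⊗ₘ 𝒮[H]) ≫ (β_ H H).hom ≫ μ[H] ≫ χ := by
          rw [← Category.assoc, HopfObj.mul_antipode]; simp only [Category.assoc]
      _ = _ := by
          rw [IsMonHom.mul_hom, ← BraidedCategory.braiding_naturality_assoc,
            tensorHom_comp_tensorHom_assoc]
          simp [← unitors_equal]

/-- The product `χ * (χ ∘ S) = 1`, written out as it unfolds in `Conv H (𝟙_ C)`. -/
theorem conv_antipode (χ : H ⟶ 𝟙_ C) [IsMonHom χ] :
    Δ[H] ≫ χ ▷ H ≫ 𝟙_ C ◁ (𝒮[H] ≫ χ) ≫ μ[𝟙_ C] = ε[H] ≫ η[𝟙_ C] := by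
  calc _ = Δ[H] ≫ H ◁ 𝒮[H] ≫ (χ ⊗ₘ χ) ≫ μ[𝟙_ C] := by
        rw [MonoidalCategory.tensorHom_def, whiskerLeft_comp]
        simp only [Category.assoc]
        rw [whisker_exchange_assoc]
    _ = _ := by
        rw [← IsMonHom.mul_hom, HopfObj.antipode_right_assoc, IsMonHom.one_hom]

/-- In the convolution monoid, `χ ∘ S` has left inverse `χ` and right inverse `χ ∘ S ∘ S`, which
therefore coincide. -/
theorem antipode_antipode_character (χ : H ⟶ 𝟙_ C) [IsMonHom χ] : 𝒮[H] ≫ 𝒮[H] ≫ χ = χ := by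
  have := isMonHom_antipode_comp χ
  exact (left_inv_eq_right_inv (M := Conv H (𝟙_ C)) (a := 𝒮[H] ≫ χ) (conv_antipode χ)
    (conv_antipode (𝒮[H] ≫ χ))).symm

/-- The counit action on `V` absorbs one leg of `Δ`, leaving only `χ`. -/
theorem tensorActRight_triv_character (V : C) (χ : H ⟶ 𝟙_ C) :
    tensorActRight (trivRight V) ((λ_ H).hom ≫ χ) ≫ (ρ_ V).hom =
      (ρ_ V).hom ▷ H ≫ V ◁ χ ≫ (ρ_ V).hom := by
  have e := tensorμ_natural_right V (𝟙_ C) ε[H] (𝟙 H)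
  simp only [tensorHom_id, whiskerLeft_id] at e
  calc _ = (V ⊗ 𝟙_ C) ◁ Δ[H] ≫ (tensorμ V (𝟙_ C) H H ≫ (V ◁ ε[H]) ▷ (𝟙_ C ⊗ H)) ≫
        ((ρ_ V).hom ⊗ₘ ((λ_ H).hom ≫ χ)) ≫ (ρ_ V).hom := by
        simp only [tensorActRight, trivRight, MonoidalCategory.tensorHom_def, comp_whiskerRight,
          Category.assoc]
    _ = (V ⊗ 𝟙_ C) ◁ (Δ[H] ≫ ε[H] ▷ H) ≫ tensorμ V (𝟙_ C) (𝟙_ C) H ≫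
        ((ρ_ V).hom ⊗ₘ ((λ_ H).hom ≫ χ)) ≫ (ρ_ V).hom := by
        rw [← e]; simp only [whiskerLeft_comp, Category.assoc]
    _ = _ := by
        rw [ComonObj.counit_comul]
        simp only [tensorμ, braiding_tensorUnit_left, MonoidalCategory.tensorHom_def]
        monoidal

/-- The bimodule law brackets the adjoint action as `(S(h₁) m) h₂`, so its two factors can be
evaluated on `Λ` one at a time. -/
theorem adAct_eq {M : C} {a : H ⊗ M ⟶ M} {c : M ⊗ H ⟶ M}
    (hac : a ▷ H ≫ c = (α_ _ _ _).hom ≫ H ◁ c ≫ a) :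
    adAct a c = M ◁ Δ[H] ≫ (α_ _ _ _).inv ≫ ((β_ M H).hom ≫ 𝒮[H] ▷ M ≫ a) ▷ H ≫ c := by
  simp only [comp_whiskerRight, Category.assoc, hac, adAct, MonoidalCategory.tensorHom_def]
  simp

end character

/-! ### Transporting the adjoint action along the pairing -/

section pairing
variable {C : Type u} [Category.{v} C] [MonoidalCategory C] [BraidedCategory C]
variable {H : C} [HopfObj H] [HasRightDual H] [HasEqualizers C]

/-- Evaluating a transposed operator on `Λ` is evaluating `f` on its value at `Λ`. Both actions on
`H^*` are treated through this. -/
theorem dualOp_evInt {b : H ⊗ H ⟶ H} {χ : H ⟶ 𝟙_ C}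
    (h : H ◁ intι H ≫ b = χ ▷ IntObj H ≫ (λ_ _).hom ≫ intι H) :
    dualOp b ▷ IntObj H ≫ evInt H = ((Hᘁ : C) ◁ χ ≫ (ρ_ _).hom) ▷ IntObj H ≫ evInt H := by
  calc _ = (Hᘁ ⊗ H : C) ◁ intι H ≫ dualOp b ▷ H ≫ ε_ H Hᘁ := by
        rw [evInt, whisker_exchange_assoc]
    _ = (α_ _ _ _).hom ≫ (Hᘁ : C) ◁ (H ◁ intι H ≫ b) ≫ ε_ H Hᘁ := by
        rw [dualOp_ev]; simp
    _ = _ := by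
        rw [h, evInt]; monoidal

/-- `f(Λ S⁻¹(h)) = ε(S⁻¹(h)) f(Λ) = ε(h) f(Λ)`. -/
theorem dualActRight_evInt [IsIso 𝒮[H]] : dualActRight μ[H] ▷ IntObj H ≫ evInt H =
    ((Hᘁ : C) ◁ ε[H] ≫ (ρ_ _).hom) ▷ IntObj H ≫ evInt H := by
  apply dualOp_evInt
  have hΛ := isRightIntegral_intι H
  rw [IsRightIntegral] at hΛ
  have hS : inv 𝒮[H] ≫ ε[H] = ε[H] := by rw [IsIso.inv_comp_eq, HopfObj.antipode_counit]
  rw [BraidedCategory.braiding_inv_naturality_right_assoc, ← whisker_exchange_assoc, hΛ,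
    ← whiskerLeft_comp_assoc, hS, ← BraidedCategory.braiding_inv_naturality_left_assoc,
    braiding_inv_tensorUnit_right]
  simp

/-- Two antipodes meet, one from the adjoint action and one from the action on `H^*`: `f(S²(h) Λ) =
χ(S²(h)) f(Λ) = χ(h) f(Λ)`. -/
theorem antipode_dualActLeft_evInt {χ : H ⟶ 𝟙_ C} (hχ : IsModularFunction H χ) :
    ((β_ (Hᘁ : C) H).hom ≫ 𝒮[H] ▷ (Hᘁ : C) ≫ dualActLeft μ[H]) ▷ IntObj H ≫ evInt H =
      ((Hᘁ : C) ◁ χ ≫ (ρ_ _).hom) ▷ IntObj H ≫ evInt H := by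
  have := hχ.toIsMonHom
  calc _ = ((β_ (Hᘁ : C) H).hom ≫ 𝒮[H] ▷ (Hᘁ : C) ≫ (β_ H Hᘁ).hom ≫ (Hᘁ : C) ◁ 𝒮[H]) ▷ IntObj H ≫
        (dualOp μ[H] ▷ IntObj H ≫ evInt H) := by
        simp only [dualActLeft, comp_whiskerRight, Category.assoc]
    _ = ((β_ (Hᘁ : C) H).hom ≫ 𝒮[H] ▷ (Hᘁ : C) ≫ (β_ H Hᘁ).hom ≫ (Hᘁ : C) ◁ (𝒮[H] ≫ χ) ≫
          (ρ_ _).hom) ▷ IntObj H ≫ evInt H := by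
        rw [dualOp_evInt hχ.act_int]
        simp only [comp_whiskerRight, whiskerLeft_comp, Category.assoc]
    _ = _ := by
        -- Since `χ` takes values in the unit object, naturality trivializes both braidings of `h`
        -- past `f`.
        rw [← BraidedCategory.braiding_naturality_left_assoc, ← comp_whiskerRight_assoc,
          antipode_antipode_character, ← BraidedCategory.braiding_naturality_right_assoc]
        simp

/-- The right factor contributes `ε(h₂)`, which reduces `Δ(h)` to `h`; the left factor contributes
`χ`. This holds for every functional, coinvariant or not. -/
theorem adAct_evInt [IsIso 𝒮[H]] {χ : H ⟶ 𝟙_ C} (hχ : IsModularFunction H χ) :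
    adAct (dualActLeft μ[H]) (dualActRight μ[H]) ▷ IntObj H ≫ evInt H =
      ((Hᘁ : C) ◁ χ ≫ (ρ_ _).hom) ▷ IntObj H ≫ evInt H := by
  have e : adAct (dualActLeft μ[H]) (dualActRight μ[H]) = _ := adAct_eq (dualRegular H).middle_assoc
  refine (congrArg (fun f => f ▷ IntObj H ≫ evInt H) e).trans ?_
  rw [← antipode_dualActLeft_evInt hχ]
  generalize (β_ (Hᘁ : C) H).hom ≫ 𝒮[H] ▷ (Hᘁ : C) ≫ dualActLeft μ[H] = a
  calc _ = ((Hᘁ : C) ◁ Δ[H] ≫ (α_ _ _ _).inv ≫ a ▷ H) ▷ IntObj H ≫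
        (dualActRight μ[H] ▷ IntObj H ≫ evInt H) := by
        simp only [comp_whiskerRight, Category.assoc]
    _ = ((Hᘁ : C) ◁ Δ[H] ≫ (α_ _ _ _).inv ≫ (a ▷ H ≫ (Hᘁ : C) ◁ ε[H]) ≫ (ρ_ _).hom) ▷ IntObj H ≫
          evInt H := by
        rw [dualActRight_evInt]; simp only [comp_whiskerRight, Category.assoc]
    _ = ((Hᘁ : C) ◁ (Δ[H] ≫ H ◁ ε[H]) ≫ (α_ _ _ _).inv ≫ (ρ_ _).hom ≫ a) ▷ IntObj H ≫ evInt H := by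
        rw [← whisker_exchange]; monoidal
    _ = _ := by
        rw [ComonObj.comul_counit]; simp

/-- As `π` is idempotent, its equalizer with the identity splits it, so the fundamental isomorphism
exists for the actual coinvariants; cancelling the now invertible `S` and the braiding leaves
`dualGen`. -/
theorem isIso_dualGen_coinvι [IsIso 𝒮[H]] :
    IsIso (dualGen (H := H) (dualRegular H).coinvι) := by
  have ip : (dualRegular H).proj ≫ (dualRegular H).proj = (dualRegular H).proj :=
    pi_idem (isLeft_mul (H := H)).dual.toLeft dualCoact_counit dualCoact_coassoc dualCoact_left
  let q : (dualRegular H).X ⟶ (dualRegular H).coinvObj :=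
    equalizer.lift (dualRegular H).proj (by rw [ip, Category.comp_id])
  have hq : q ≫ (dualRegular H).coinvι = (dualRegular H).proj := equalizer.lift_ι _ _
  have hi : (dualRegular H).coinvι ≫ q = 𝟙 _ := by
    rw [← cancel_mono (dualRegular H).coinvι, Category.assoc, hq, HopfBimod.coinvι_proj,
      Category.id_comp]
  have hθ : (dualFundamentalIso H hi hq).hom = _ := act_eq_dualGen (H := H) (dualRegular H).coinvι
  rw [← Category.assoc] at hθ
  have : IsIso ((𝒮[H] ▷ (dualRegular H).coinvObj ≫ (β_ H _).hom) ≫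
      dualGen (H := H) (dualRegular H).coinvι) := by
    rw [← hθ]; infer_instance
  exact IsIso.of_isIso_comp_left (𝒮[H] ▷ (dualRegular H).coinvObj ≫ (β_ H _).hom) _

variable (H) in
/-- The pairing of the coinvariants of the dual of `H` with the integrals in `H`. -/
noncomputable def coinvPairing [IsIso 𝒮[H]] : (dualRegular H).coinvObj ⊗ IntObj H ⟶ 𝟙_ C :=
  (show (dualRegular H).coinvObj ⟶ (Hᘁ : C) from (dualRegular H).coinvι) ▷ IntObj H ≫ evInt H

theorem coinvAct_pairing [IsIso 𝒮[H]] {χ : H ⟶ 𝟙_ C} (hχ : IsModularFunction H χ) :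
    (dualRegular H).coinvAct ▷ IntObj H ≫ coinvPairing H =
      ((dualRegular H).coinvObj ◁ χ ≫ (ρ_ _).hom) ▷ IntObj H ≫ coinvPairing H := by
  have h := adAct_evInt hχ
  have hι : (dualRegular H).coinvAct ≫
      (show (dualRegular H).coinvObj ⟶ (Hᘁ : C) from (dualRegular H).coinvι) =
        (show (dualRegular H).coinvObj ⟶ (Hᘁ : C) from (dualRegular H).coinvι) ▷ H ≫
          adAct (dualActLeft μ[H]) (dualActRight μ[H]) := (dualRegular H).coinvAct_ι
  rw [coinvPairing]
  generalize (show (dualRegular H).coinvObj ⟶ (Hᘁ : C) from (dualRegular H).coinvι) = i at hι ⊢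
  rw [← comp_whiskerRight_assoc, hι, comp_whiskerRight_assoc, h, ← comp_whiskerRight_assoc,
    ← comp_whiskerRight_assoc, ← whisker_exchange_assoc, Category.assoc, rightUnitor_naturality]

theorem coinvAct_toDual [IsIso 𝒮[H]] [HasRightDual (IntObj H)] {χ : H ⟶ 𝟙_ C}
    (hχ : IsModularFunction H χ) :
    (dualRegular H).coinvAct ≫ toDual (coinvPairing H) =
      toDual (coinvPairing H) ▷ H ≫ ((IntObj H)ᘁ : C) ◁ χ ≫ (ρ_ _).hom := by
  apply dual_hom_ext
  rw [comp_whiskerRight_assoc, toDual_ev, coinvAct_pairing hχ, ← whisker_exchange_assoc,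
    rightUnitor_naturality, ← Category.assoc, comp_whiskerRight_assoc _ (toDual _), toDual_ev]

/-- An isomorphism of underlying objects compatible with the actions is an isomorphism of right
modules. -/
def RightMod.isoMk {M N : RightMod H} (e : M.X ≅ N.X) (h : M.act ≫ e.hom = e.hom ▷ H ≫ N.act) :
    M ≅ N where
  hom := ⟨e.hom, h⟩
  inv := ⟨e.inv, linR_inv h⟩
  hom_inv_id := RightMod.Hom.ext e.hom_inv_id
  inv_hom_id := RightMod.Hom.ext e.inv_hom_id

end pairing
end BraidedHopf

/-! ### The main theorem -/

theorem lemma5p6 {C : Type u} [Category.{v} C] [MonoidalCategory C] [BraidedCategory C]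
    [RigidCategory C] [HasEqualizers C] (H : C) [HopfObj H] :
    ∃ _ : IsIso 𝒮[H],
      (∃! χ : H ⟶ 𝟙_ C, BraidedHopf.IsModularFunction H χ) ∧
      ∀ (χ : H ⟶ 𝟙_ C) (hχ : BraidedHopf.IsModularFunction H χ),
        haveI := hχ.toIsMonHom
        Nonempty ((BraidedHopf.dualRegular H).coinv ≅
          (BraidedHopf.RightMod.trivial H (BraidedHopf.IntObj H)ᘁ).tensor
            (BraidedHopf.RightMod.ofCharacter χ)) := by
  have hS := BraidedHopf.isIso_antipode H
  have := BraidedHopf.isIso_dualGen_coinvι (H := H)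
  have hP : IsIso (BraidedHopf.coinvPairing H) :=
    BraidedHopf.isIso_pairing (H := H) (BraidedHopf.dualRegular H).coinvι
  have := BraidedHopf.isEquivalence_tensorRight (asIso (BraidedHopf.coinvPairing H))
  refine ⟨hS, BraidedHopf.existsUnique_modularFunction, fun χ hχ => ?_⟩
  have := BraidedHopf.isIso_toDual (BraidedHopf.coinvPairing H)
  -- The unitor is needed because the target lives on `Int(H)^* ⊗ 𝟙_ C`.
  let e := asIso (BraidedHopf.toDual (BraidedHopf.coinvPairing H)) ≪≫ (ρ_ _).symm
  refine ⟨BraidedHopf.RightMod.isoMk e ?_⟩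
  change (BraidedHopf.dualRegular H).coinvAct ≫ BraidedHopf.toDual (BraidedHopf.coinvPairing H) ≫
      (ρ_ _).inv = (BraidedHopf.toDual (BraidedHopf.coinvPairing H) ≫ (ρ_ _).inv) ▷ H ≫
    BraidedHopf.tensorActRight (BraidedHopf.trivRight _) ((λ_ H).hom ≫ χ)
  rw [← cancel_mono (ρ_ _).hom]
  simp only [Category.assoc]
  rw [BraidedHopf.tensorActRight_triv_character, Iso.inv_hom_id, Category.comp_id,
    BraidedHopf.coinvAct_toDual hχ, comp_whiskerRight_assoc, inv_hom_whiskerRight_assoc]
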